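/- For integers $m,n\ge 3$ let $R_{2,m}\subset\mathbb R^{2\times m}$ be the set of real $2\times m$ matrices $M$ whose columns are in convex position and affinely span $\mathbb R^2$, and let $P(M)\subset\mathbb R^2$ be the convex hull of the columns of $M$ (an $m$-gon). Let $R'_{2,n}\subset\mathbb R^{n\times 2}$ be the set of real $n\times 2$ matrices $M'$ for which $Q(M')=\{x\in\mathbb R^2 : M'x\le \mathbf 1\}$ (coordinatewise inequality, $\mathbf 1=(1,\dots,1)$) is a $2$-dimensional polytope with exactly $n$ facets (an $n$-gon). For such $M,M'$ let $\mathrm{Hom}(P(M),Q(M'))$ be the polytope of all affine maps $f:\mathbb R^2\to\mathbb R^2$ with $f(P(M))\subset Q(M')$, viewed in the $6$-dimensional vector space of affine maps $\mathbb R^2\to\mathbb R^2$. A vertex of a $d$-dimensional polytope is called simple if it lies in exactly $d$ facets. There are dense open subsets $V_{m,n}$ of $R_{2,m}\times R'_{2,n}$ (for all $m,n\ge3$) with the following property: for every $m\ge 3$ and every $\varepsilon>0$ there is an $N$ such that for all $n\ge \max(N,3)$ and all $(M,M')\in V_{m,n}$, $$\left|\frac{\#\{\text{simple vertices of }\mathrm{Hom}(P(M),Q(M'))\}}{\#\{\text{vertices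 of }\mathrm{Hom}(P(M),Q(M'))\}}-1\right|<\varepsilon .$$ That is, for fixed $m$ the proportion of simple vertices tends to $1$ as $n\to\infty$, uniformly over $(M,M')\in V_{m,n}$. -/

import Mathlib

open Set

namespace HomPolytope

/-- The dimension of a nonempty convex subset `X` of a finite-dimensional real vector space:
the dimension of the linear space parallel to its affine hull. -/
noncomputable def dim {E : Type*} [AddCommGroup E] [Module ℝ E] (X : Set E) : ℕ :=
  Module.finrank ℝ (vectorSpan ℝ X)

/-- `F` is a nonempty face of the polytope `X`: the (nonempty) set of points of `X` at which some
linear functional attains its maximum over `X`. -/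
def IsFace {E : Type*} [AddCommGroup E] [Module ℝ E] (X F : Set E) : Prop :=
  F.Nonempty ∧ ∃ l : E →ₗ[ℝ] ℝ, F = {x ∈ X | ∀ y ∈ X, l y ≤ l x}

/-- The set of facets of a polytope `X`: the nonempty faces of dimension `dim X - 1`. -/
def facets {E : Type*} [AddCommGroup E] [Module ℝ E] (X : Set E) : Set (Set E) :=
  {F | IsFace X F ∧ dim F + 1 = dim X}

/-- The set of vertices of a polytope `X`. -/
def vertices {E : Type*} [AddCommGroup E] [Module ℝ E] (X : Set E) : Set E :=
  X.extremePoints ℝ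

/-- The set of simple vertices of a polytope `X`: the vertices that lie in exactly `dim X`
facets. -/
def simpleVertices {E : Type*} [AddCommGroup E] [Module ℝ E] (X : Set E) : Set E :=
  {v ∈ vertices X | {F ∈ facets X | v ∈ F}.encard = dim X}

/-- The polytope `P(M)` in `ℝ^d`: the convex hull of the columns of `M`. -/
def colPolytope {d m : ℕ} (M : Matrix (Fin d) (Fin m) ℝ) : Set (Fin d → ℝ) :=
  convexHull ℝ (range fun j i => M i j)

/-- The polyhedron `Q(M')` in `ℝ^e`: the set of solutions of `M' x ≤ 1` (coordinatewise). -/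
def rowPolyhedron {e n : ℕ} (M' : Matrix (Fin n) (Fin e) ℝ) : Set (Fin e → ℝ) :=
  {x | ∀ i, M'.mulVec x i ≤ 1}

/-- `R_{d,m}`: the `d × m` matrices whose columns are in convex position and affinely
span `ℝ^d`. -/
def colRealizations (d m : ℕ) : Set (Matrix (Fin d) (Fin m) ℝ) :=
  {M | ConvexIndependent ℝ (fun (j : Fin m) (i : Fin d) => M i j) ∧
    affineSpan ℝ (range fun (j : Fin m) (i : Fin d) => M i j) = ⊤}

/-- `R'_{e,n}`: the `n × e` matrices `M'` for which the polyhedron `Q(M')` is an `e`-polytope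
(compact of dimension `e`) with `n` facets. -/
def rowRealizations (e n : ℕ) : Set (Matrix (Fin n) (Fin e) ℝ) :=
  {M' | IsCompact (rowPolyhedron M') ∧ dim (rowPolyhedron M') = e ∧
    (facets (rowPolyhedron M')).encard = n}

/-- The hom-polytope `Hom(P, Q)` of affine maps `P → Q`, as a subset of the vector space of affine
maps `E → E'`. It is meant for `P` with affine hull `E`, when an affine map on `P` is the
restriction of exactly one affine map on `E`. -/
def homPolytope {E E' : Type*} [AddCommGroup E] [Module ℝ E] [AddCommGroup E'] [Module ℝ E']
    (P : Set E) (Q : Set E') : Set (E →ᵃ[ℝ] E') :=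
  {f | MapsTo f P Q}

/-- The proportion of simple vertices among all vertices of a polytope `X`. -/
noncomputable def simpleRatio {E : Type*} [AddCommGroup E] [Module ℝ E] (X : Set E) : ℝ :=
  ((simpleVertices X).ncard : ℝ) / ((vertices X).ncard : ℝ)

end HomPolytope

/-!
For generic data the edge lines of `Q` are in general position and no two secants of the vertices of
`P` are parallel. A vertex `f` of the hom-polytope is governed by its tight pairs: a column `v` of
`M` and an edge line of `Q` through `f v`.

Non-simple vertices are few. Such an `f` has more than `6` tight pairs. If `f` were injective, then
moving the columns of `M` would make seven of the corresponding equations inconsistent, so their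
augmented determinant, a polynomial in `(M, M')`, is not identically zero; hence it is nonzero at
the generic data, although `f` is a common solution. So `f` collapses `P` to a segment. The columns
mapped to the two endpoints are at most three in number, each in at most two tight pairs, so some
other column is in a tight pair too, and the whole segment lies on one edge line of `Q`. Given that
line, there are at most three possible sets of edge lines through the image of each column, which
leaves at most `n * 3 ^ m` such `f`.

Simple vertices are many. Choose an edge of `P` with a unique farthest vertex from its line. For any
two vertices `u` and `w` of `Q` that share no edge, the affine map onto the segment `[u, w]` that
sends the edge to `u` and the farthest vertex to `w` is a vertex with exactly six tight pairs. There
are of order `n ^ 2` of these.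
-/

namespace HomPolytope

open Filter Topology

section Polyhedra

variable {E K : Type*} [AddCommGroup E] [Module ℝ E]

/-- The polyhedron cut out by the inequalities `l k x ≤ b k`. -/
def polyhedron (l : K → E →ₗ[ℝ] ℝ) (b : K → ℝ) : Set E := {x | ∀ k, l k x ≤ b k}

/-- The inequalities that are equalities at the point `x`. -/
def tight (l : K → E →ₗ[ℝ] ℝ) (b : K → ℝ) (x : E) : Set K := {k | l k x = b k}

/-- The face of a polyhedron on which the inequality `k` is tight. -/
def tightFace (l : K → E →ₗ[ℝ] ℝ) (b : K → ℝ) (k : K) : Set E :=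
  polyhedron l b ∩ {x | l k x = b k}

/-- The inequality `k` cannot be left out: some point makes it tight and all the others strict. -/
def IsIrredundant (l : K → E →ₗ[ℝ] ℝ) (b : K → ℝ) (k : K) : Prop :=
  ∃ x, l k x = b k ∧ ∀ k', k' ≠ k → l k' x < b k'

variable {l : K → E →ₗ[ℝ] ℝ} {b : K → ℝ} {x x₀ v : E} {k : K}

lemma mem_tight : k ∈ tight l b x ↔ l k x = b k := Iff.rfl

lemma polyhedron_eq_iInter : polyhedron l b = ⋂ k, {x | l k x ≤ b k} := ofPred_forall _

lemma convex_polyhedron : Convex ℝ (polyhedron l b) := by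
  rw [polyhedron_eq_iInter]
  exact convex_iInter fun k => convex_halfSpace_le (l k).isLinear (b k)

lemma convex_tightFace : Convex ℝ (tightFace l b k) :=
  convex_polyhedron.inter (convex_hyperplane (l k).isLinear (b k))

lemma eventually_apply_add_smul_lt [Finite K] (x v : E) :
    ∀ᶠ t : ℝ in 𝓝 0, ∀ k, l k x < b k → l k (x + t • v) < b k := by
  refine eventually_all.2 fun k => eventually_imp_distrib_left.2 fun hk => ?_
  have hcont : Continuous fun t : ℝ => l k x + t * l k v := by fun_prop
  simpa using hcont.continuousAt.eventually_lt (x₀ := 0) continuousAt_const (by simpa using hk)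

lemma exists_pos_apply_add_smul_lt [Finite K] (x v : E) :
    ∃ t : ℝ, 0 < t ∧ ∀ k, l k x < b k → l k (x + t • v) < b k ∧ l k (x - t • v) < b k := by
  have hpos := (eventually_apply_add_smul_lt (l := l) (b := b) x v).and
    (eventually_apply_add_smul_lt (l := l) (b := b) x (-v))
  obtain ⟨t, ⟨hv, hnegv⟩, ht⟩ :=
    ((hpos.filter_mono nhdsWithin_le_nhds).and (self_mem_nhdsWithin (s := Ioi 0))).exists
  exact ⟨t, ht, fun k hk => ⟨hv k hk, by simpa [sub_eq_add_neg] using hnegv k hk⟩⟩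

lemma exists_forall_apply_lt {C : Set E} (hC : Convex ℝ C) (hne : C.Nonempty)
    (hCl : C ⊆ polyhedron l b) (s : Finset K) (h : ∀ k ∈ s, ∃ x ∈ C, l k x < b k) :
    ∃ x ∈ C, ∀ k ∈ s, l k x < b k := by
  classical
  induction s using Finset.induction_on with
  | empty => exact ⟨hne.some, hne.some_mem, by simp⟩
  | insert k s _ ih =>
    obtain ⟨x, hx, hxs⟩ := ih fun k' hk' => h k' (Finset.mem_insert_of_mem hk')
    obtain ⟨y, hy, hyk⟩ := h k (Finset.mem_insert_self k s)
    refine ⟨(1 / 2 : ℝ) • x + (1 / 2 : ℝ) • y,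
      hC hx hy (by norm_num) (by norm_num) (by norm_num), fun k' hk' => ?_⟩
    simp only [map_add, map_smul, smul_eq_mul]
    rcases Finset.mem_insert.1 hk' with rfl | hk'
    · linarith [hCl hx k']
    · linarith [hCl hy k', hxs k' hk']

lemma mem_vectorSpan_of_add_smul_mem {X : Set E} {t : ℝ} (ht : t ≠ 0) (hx : x ∈ X)
    (h : x + t • v ∈ X) : v ∈ vectorSpan ℝ X := by
  have htv : (x + t • v) - x ∈ vectorSpan ℝ X := vsub_mem_vectorSpan ℝ h hx
  rwa [add_sub_cancel_left, Submodule.smul_mem_iff _ ht] at htv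

lemma vectorSpan_le_ker {X : Set E} {g : E →ₗ[ℝ] ℝ} {c : ℝ} (h : ∀ x ∈ X, g x = c) :
    vectorSpan ℝ X ≤ LinearMap.ker g := by
  rw [vectorSpan_def, Submodule.span_le]
  rintro _ ⟨x, hx, y, hy, rfl⟩
  simp [h x hx, h y hy]

lemma dim_polyhedron [Finite K] (h₀ : ∀ k, l k x₀ < b k) :
    dim (polyhedron l b) = Module.finrank ℝ E := by
  suffices vectorSpan ℝ (polyhedron l b) = ⊤ by rw [dim, this, finrank_top]
  refine eq_top_iff.2 fun v _ => ?_
  obtain ⟨t, ht, h⟩ := exists_pos_apply_add_smul_lt (l := l) (b := b) x₀ v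
  exact mem_vectorSpan_of_add_smul_mem ht.ne' (fun k => (h₀ k).le) fun k => (h k (h₀ k)).1.le

lemma form_ne_zero_of_mem_tight (h₀ : ∀ k, l k x₀ < b k) (hk : k ∈ tight l b x) : l k ≠ 0 := by
  intro h
  have h1 := h₀ k
  rw [← mem_tight.1 hk, h] at h1
  exact lt_irrefl _ h1

lemma eq_zero_of_forall_le_polyhedron [Finite K] (hx : ∀ k, l k x < b k) {g : E →ₗ[ℝ] ℝ}
    (hg : ∀ y ∈ polyhedron l b, g y ≤ g x) : g = 0 := by
  ext v
  obtain ⟨t, ht, h⟩ := exists_pos_apply_add_smul_lt (l := l) (b := b) x v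
  have hplus := hg (x + t • v) fun k => (h k (hx k)).1.le
  have hminus := hg (x - t • v) fun k => (h k (hx k)).2.le
  simp only [map_add, map_sub, map_smul, smul_eq_mul] at hplus hminus
  have : t * g v = 0 := by linarith
  simpa [ht.ne'] using this

end Polyhedra

section Faces

variable {E : Type*} [AddCommGroup E] [Module ℝ E] {X F : Set E}

lemma IsFace.subset (hF : IsFace X F) : F ⊆ X := by
  obtain ⟨-, g, rfl⟩ := hF
  exact fun x hx => hx.1

lemma IsFace.convex (hX : Convex ℝ X) (hF : IsFace X F) : Convex ℝ F := by
  obtain ⟨-, g, rfl⟩ := hF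
  have : {x | ∀ y ∈ X, g y ≤ g x} = ⋂ y ∈ X, {x | g y ≤ g x} := by ext; simp
  refine hX.inter ?_
  change Convex ℝ {x | ∀ y ∈ X, g y ≤ g x}
  rw [this]
  exact convex_iInter₂ fun y _ => convex_halfSpace_ge g.isLinear (g y)

lemma IsFace.mem_of_sub_mem_vectorSpan (hF : IsFace X F) {x y : E} (hx : x ∈ X) (hy : y ∈ F)
    (hxy : x - y ∈ vectorSpan ℝ F) : x ∈ F := by
  obtain ⟨-, g, rfl⟩ := hF
  have hconst : ∀ z ∈ {z ∈ X | ∀ w ∈ X, g w ≤ g z}, g z = g y :=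
    fun z hz => le_antisymm (hy.2 z hz.1) (hz.2 y hy.1)
  have hgx : g x = g y := by
    simpa [sub_eq_zero] using vectorSpan_le_ker hconst hxy
  exact ⟨hx, fun w hw => hgx ▸ hy.2 w hw⟩

end Faces

section Facets

variable {E K : Type*} [AddCommGroup E] [Module ℝ E] {l : K → E →ₗ[ℝ] ℝ} {b : K → ℝ}
  {x x₀ : E} {k : K} {F : Set E}

lemma mem_tightFace_of_forall_lt (hxk : l k x = b k) (hx : ∀ k', k' ≠ k → l k' x < b k') :
    x ∈ tightFace l b k := by
  refine ⟨fun k' => ?_, hxk⟩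
  rcases eq_or_ne k' k with rfl | hk'
  exacts [hxk.le, (hx k' hk').le]

lemma injOn_tightFace : InjOn (tightFace l b) {k | IsIrredundant l b k} := by
  rintro k ⟨x, hxk, hx⟩ k' _ heq
  by_contra hne
  have hxk' : x ∈ tightFace l b k' := heq ▸ mem_tightFace_of_forall_lt hxk hx
  exact (hx k' (Ne.symm hne)).ne hxk'.2

lemma isFace_tightFace (h : (tightFace l b k).Nonempty) :
    IsFace (polyhedron l b) (tightFace l b k) := by
  obtain ⟨x, hx, hxk⟩ := h
  refine ⟨⟨x, hx, hxk⟩, l k, Subset.antisymm (fun y hy => ⟨hy.1, fun z hz => ?_⟩) fun y hy => ?_⟩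
  · exact (hz k).trans_eq hy.2.symm
  · exact ⟨hy.1, le_antisymm (hy.1 k) (hxk ▸ hy.2 x hx)⟩

lemma IsIrredundant.vectorSpan_tightFace [Finite K] (hk : IsIrredundant l b k) :
    vectorSpan ℝ (tightFace l b k) = LinearMap.ker (l k) := by
  refine le_antisymm (vectorSpan_le_ker fun y hy => hy.2) fun v hv => ?_
  obtain ⟨x, hxk, hx⟩ := hk
  obtain ⟨t, ht, h⟩ := exists_pos_apply_add_smul_lt (l := l) (b := b) x v
  refine mem_vectorSpan_of_add_smul_mem ht.ne' (mem_tightFace_of_forall_lt hxk hx)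
    (mem_tightFace_of_forall_lt ?_ fun k' hk' => ?_)
  · simp [LinearMap.mem_ker.1 hv, hxk]
  · exact (h k' (hx k' hk')).1

lemma exists_forall_mem_tight_of_mem_facets [Finite K] (hF : F ∈ facets (polyhedron l b)) :
    ∃ k, ∀ x ∈ F, k ∈ tight l b x := by
  have := Fintype.ofFinite K
  obtain ⟨hface, hdim⟩ := hF
  by_contra! hcon
  obtain ⟨x, hxF, hx⟩ := exists_forall_apply_lt (l := l) (b := b)
    (hface.convex convex_polyhedron) hface.1 hface.subset Finset.univ fun k _ => by
      obtain ⟨x, hxF, hxk⟩ := hcon k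
      exact ⟨x, hxF, (hface.subset hxF k).lt_of_ne hxk⟩
  obtain ⟨-, g, rfl⟩ := hface
  obtain rfl : g = 0 := eq_zero_of_forall_le_polyhedron (fun k => hx k (Finset.mem_univ k)) hxF.2
  simp at hdim

variable [FiniteDimensional ℝ E] [Finite K]

lemma IsIrredundant.tightFace_mem_facets (h₀ : ∀ k, l k x₀ < b k) (hk : IsIrredundant l b k) :
    tightFace l b k ∈ facets (polyhedron l b) := by
  have hspan := hk.vectorSpan_tightFace
  obtain ⟨x, hxk, hx⟩ := hk
  refine ⟨isFace_tightFace ⟨x, mem_tightFace_of_forall_lt hxk hx⟩, ?_⟩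
  rw [dim_polyhedron h₀, dim, hspan,
    Module.Dual.finrank_ker_add_one_of_ne_zero (form_ne_zero_of_mem_tight h₀ hxk)]

lemma eq_tightFace_of_mem_facets (h₀ : ∀ k, l k x₀ < b k) (hF : F ∈ facets (polyhedron l b))
    (hk : ∀ x ∈ F, k ∈ tight l b x) : F = tightFace l b k := by
  obtain ⟨hface, hdim⟩ := hF
  obtain ⟨y, hy⟩ := hface.1
  have hker : vectorSpan ℝ F = LinearMap.ker (l k) := by
    apply Submodule.eq_of_le_of_finrank_eq (vectorSpan_le_ker hk)
    have := Module.Dual.finrank_ker_add_one_of_ne_zero (form_ne_zero_of_mem_tight h₀ (hk y hy))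
    rw [dim_polyhedron h₀, dim] at hdim
    lia
  refine Subset.antisymm (fun x hx => ⟨hface.subset hx, hk x hx⟩) fun x hx => ?_
  refine hface.mem_of_sub_mem_vectorSpan hx.1 hy ?_
  rw [hker, LinearMap.mem_ker, map_sub, hx.2, hk y hy, sub_self]

lemma facets_subset_range_tightFace (h₀ : ∀ k, l k x₀ < b k) :
    facets (polyhedron l b) ⊆ range (tightFace l b) := by
  intro F hF
  obtain ⟨k, hk⟩ := exists_forall_mem_tight_of_mem_facets hF
  exact ⟨k, (eq_tightFace_of_mem_facets h₀ hF hk).symm⟩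

lemma isIrredundant_of_injective_tightFace (h₀ : ∀ k, l k x₀ < b k)
    (hinj : Function.Injective (tightFace l b)) (hk : tightFace l b k ∈ facets (polyhedron l b)) :
    IsIrredundant l b k := by
  classical
  have := Fintype.ofFinite K
  have hstrict : ∀ k' ∈ Finset.univ.erase k, ∃ x ∈ tightFace l b k, l k' x < b k' := by
    intro k' hk'
    by_contra! hcon
    have htight : ∀ x ∈ tightFace l b k, k' ∈ tight l b x :=
      fun x hx => le_antisymm (hx.1 k') (hcon x hx)
    exact Finset.ne_of_mem_erase hk' (hinj (eq_tightFace_of_mem_facets h₀ hk htight)).symm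
  obtain ⟨x, hx, hlt⟩ := exists_forall_apply_lt convex_tightFace hk.1.1 inter_subset_left _ hstrict
  exact ⟨x, hx.2, fun k' hk' => hlt k' (by simpa using hk')⟩

lemma encard_facets_eq_iff (h₀ : ∀ k, l k x₀ < b k) :
    (facets (polyhedron l b)).encard = ENat.card K ↔ ∀ k, IsIrredundant l b k := by
  have hrange : (range (tightFace l b)).encard ≤ ENat.card K := by
    rw [← image_univ, ← encard_univ]
    exact encard_image_le _ _
  refine ⟨fun hcard k => ?_, fun hirr => ?_⟩
  · have hfacets : facets (polyhedron l b) = range (tightFace l b) :=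
      ((finite_range _).subset (facets_subset_range_tightFace h₀)).eq_of_subset_of_encard_le
        (facets_subset_range_tightFace h₀) (hcard ▸ hrange)
    refine isIrredundant_of_injective_tightFace h₀ ?_ (hfacets ▸ mem_range_self k)
    rw [← injOn_univ]
    apply finite_univ.injOn_of_encard_image_eq
    rw [image_univ, ← hfacets, hcard, encard_univ]
  · have hfacets : facets (polyhedron l b) = range (tightFace l b) := by
      refine Subset.antisymm (facets_subset_range_tightFace h₀) ?_
      rintro _ ⟨k, rfl⟩
      exact (hirr k).tightFace_mem_facets h₀
    have hinj : Function.Injective (tightFace l b) :=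
      fun k k' h => injOn_tightFace (hirr k) (hirr k') h
    rw [hfacets, ← image_univ, hinj.encard_image, encard_univ]

end Facets

section Vertices

variable {E K : Type*} [AddCommGroup E] [Module ℝ E] {l : K → E →ₗ[ℝ] ℝ} {b : K → ℝ}
  {u w x x₀ : E} {k : K}

/-- The linear map whose components are the forms that are tight at `x`. It is injective exactly
when these forms separate points, and surjective exactly when they are linearly independent. -/
def tightMap (l : K → E →ₗ[ℝ] ℝ) (b : K → ℝ) (x : E) : E →ₗ[ℝ] (tight l b x → ℝ) :=
  LinearMap.pi fun k => l k

lemma injective_tightMap_iff :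
    Function.Injective (tightMap l b x) ↔ ∀ v, (∀ k ∈ tight l b x, l k v = 0) → v = 0 := by
  rw [← LinearMap.ker_eq_bot, LinearMap.ker_eq_bot']
  simp [tightMap, funext_iff]

lemma inter_subset_tight_lineMap (s : ℝ) :
    tight l b u ∩ tight l b w ⊆ tight l b (AffineMap.lineMap u w s) := by
  rintro k ⟨hku, hkw⟩
  rw [mem_tight, AffineMap.lineMap_apply_module, map_add, map_smul, map_smul, mem_tight.1 hku,
    mem_tight.1 hkw, ← add_smul, sub_add_cancel, one_smul]

lemma tight_lineMap (hu : u ∈ polyhedron l b) (hw : w ∈ polyhedron l b) {s : ℝ}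
    (hs : s ∈ Ioo (0 : ℝ) 1) :
    tight l b (AffineMap.lineMap u w s) = tight l b u ∩ tight l b w := by
  refine Subset.antisymm (fun k hk => ?_) (inter_subset_tight_lineMap s)
  simp only [mem_tight, AffineMap.lineMap_apply_module, map_add, map_smul, smul_eq_mul] at hk
  have hsu := mul_le_mul_of_nonneg_left (hu k) (sub_pos.2 hs.2).le
  have hsw := mul_le_mul_of_nonneg_left (hw k) hs.1.le
  exact ⟨mul_left_cancel₀ (sub_pos.2 hs.2).ne' (by linarith),
    mul_left_cancel₀ hs.1.ne' (by linarith)⟩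

lemma isExtreme_tightFace : IsExtreme ℝ (polyhedron l b) (tightFace l b k) := by
  refine ⟨inter_subset_left, fun u hu w hw z hz hzuw => ⟨hu, ?_⟩⟩
  rw [openSegment_eq_image_lineMap] at hzuw
  obtain ⟨s, hs, rfl⟩ := hzuw
  have hk : k ∈ tight l b (AffineMap.lineMap u w s) := hz.2
  rw [tight_lineMap hu hw hs] at hk
  exact hk.1

lemma mem_vertices_polyhedron_iff [Finite K] :
    x ∈ vertices (polyhedron l b) ↔
      x ∈ polyhedron l b ∧ ∀ v, (∀ k ∈ tight l b x, l k v = 0) → v = 0 := by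
  refine ⟨fun ⟨hx, hext⟩ => ⟨hx, fun v hv => ?_⟩, fun ⟨hx, hsep⟩ => ⟨hx, fun u hu w hw huw => ?_⟩⟩
  · obtain ⟨t, ht, h⟩ := exists_pos_apply_add_smul_lt (l := l) (b := b) x v
    have hplus : x + t • v ∈ polyhedron l b := fun k => by
      rcases (hx k).lt_or_eq with hlt | heq
      · exact (h k hlt).1.le
      · simp [hv k heq, heq]
    have hminus : x - t • v ∈ polyhedron l b := fun k => by
      rcases (hx k).lt_or_eq with hlt | heq
      · exact (h k hlt).2.le
      · simp [hv k heq, heq]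
    have hmid : x ∈ openSegment ℝ (x + t • v) (x - t • v) :=
      ⟨1 / 2, 1 / 2, by norm_num, by norm_num, by norm_num, by module⟩
    have htv := hext hplus hminus hmid
    rw [add_eq_left] at htv
    exact (smul_eq_zero.1 htv).resolve_left ht.ne'
  · rw [openSegment_eq_image_lineMap] at huw
    obtain ⟨s, hs, rfl⟩ := huw
    have huw : w - u = 0 := by
      refine hsep _ fun k hk => ?_
      rw [tight_lineMap hu hw hs] at hk
      rw [map_sub, mem_tight.1 hk.1, mem_tight.1 hk.2, sub_self]
    rw [sub_eq_zero.1 huw, AffineMap.lineMap_same_apply]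

lemma injOn_tight_vertices [Finite K] : InjOn (tight l b) (vertices (polyhedron l b)) := by
  intro x hx y _ hxy
  refine sub_eq_zero.1 ((mem_vertices_polyhedron_iff.1 hx).2 (x - y) fun k hk => ?_)
  have hk' : k ∈ tight l b y := hxy ▸ hk
  rw [map_sub, mem_tight.1 hk, mem_tight.1 hk', sub_self]

lemma finite_vertices_polyhedron [Finite K] : (vertices (polyhedron l b)).Finite :=
  Set.Finite.of_injOn (fun _ _ => mem_univ _) injOn_tight_vertices Set.finite_univ

lemma isIrredundant_of_surjective_tightMap [Finite K] (hx : x ∈ polyhedron l b)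
    (hsurj : Function.Surjective (tightMap l b x)) (hk : k ∈ tight l b x) :
    IsIrredundant l b k := by
  classical
  obtain ⟨v, hv⟩ := hsurj fun k' => if k' = ⟨k, hk⟩ then 0 else -1
  obtain ⟨t, ht, h⟩ := exists_pos_apply_add_smul_lt (l := l) (b := b) x v
  have hkv : l k v = 0 := by simpa [tightMap] using congrFun hv ⟨k, hk⟩
  refine ⟨x + t • v, by simp [mem_tight.1 hk, hkv], fun k' hne => ?_⟩
  by_cases hk' : k' ∈ tight l b x
  · have hkv' : l k' v = -1 := by simpa [tightMap, hne] using congrFun hv ⟨k', hk'⟩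
    simp [hkv', mem_tight.1 hk', ht]
  · exact (h k' ((hx k').lt_of_ne hk')).1

lemma finrank_le_ncard_tight [Finite K] (hx : x ∈ vertices (polyhedron l b)) :
    Module.finrank ℝ E ≤ (tight l b x).ncard := by
  have := Fintype.ofFinite (tight l b x)
  have hinj : Function.Injective (tightMap l b x) :=
    injective_tightMap_iff.2 (mem_vertices_polyhedron_iff.1 hx).2
  simpa using LinearMap.finrank_le_finrank_of_injective hinj

lemma mem_simpleVertices_of_ncard_tight_eq [FiniteDimensional ℝ E] [Finite K]
    (h₀ : ∀ k, l k x₀ < b k) (hx : x ∈ vertices (polyhedron l b))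
    (hcard : (tight l b x).ncard = Module.finrank ℝ E) :
    x ∈ simpleVertices (polyhedron l b) := by
  have := Fintype.ofFinite (tight l b x)
  obtain ⟨hxP, hsep⟩ := mem_vertices_polyhedron_iff.1 hx
  have hfin : Module.finrank ℝ E = Module.finrank ℝ (tight l b x → ℝ) := by
    simp [← hcard]
  have hsurj := (LinearMap.injective_iff_surjective_of_finrank_eq_finrank hfin).1
    (injective_tightMap_iff.2 hsep)
  have hirr : ∀ k ∈ tight l b x, IsIrredundant l b k :=
    fun k hk => isIrredundant_of_surjective_tightMap hxP hsurj hk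
  have hfacets : {F ∈ facets (polyhedron l b) | x ∈ F} = tightFace l b '' tight l b x := by
    refine Subset.antisymm ?_ ?_
    · rintro F ⟨hF, hxF⟩
      obtain ⟨k, rfl⟩ := facets_subset_range_tightFace h₀ hF
      exact ⟨k, hxF.2, rfl⟩
    · rintro _ ⟨k, hk, rfl⟩
      exact ⟨(hirr k hk).tightFace_mem_facets h₀, hxP, hk⟩
  refine ⟨hx, ?_⟩
  rw [hfacets, (injOn_tightFace.mono hirr).encard_image, dim_polyhedron h₀, ← hcard,
    (Set.toFinite _).cast_ncard_eq]

lemma finrank_lt_ncard_tight_of_notMem_simpleVertices [FiniteDimensional ℝ E] [Finite K]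
    (h₀ : ∀ k, l k x₀ < b k) (hx : x ∈ vertices (polyhedron l b))
    (hns : x ∉ simpleVertices (polyhedron l b)) : Module.finrank ℝ E < (tight l b x).ncard :=
  (finrank_le_ncard_tight hx).lt_of_ne fun h =>
    hns (mem_simpleVertices_of_ncard_tight_eq h₀ hx h.symm)

end Vertices

section ExtremePoints

variable {E K : Type*} [AddCommGroup E] [Module ℝ E] {l : K → E →ₗ[ℝ] ℝ} {b : K → ℝ} {k : K}

lemma ncard_le_two_of_collinear {X S : Set E} (hS : S ⊆ X.extremePoints ℝ)
    (hcol : Collinear ℝ S) : S.ncard ≤ 2 := by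
  by_contra! h
  obtain ⟨x, hx, y, hy, z, hz, hxy, hxz, hyz⟩ :=
    (Set.two_lt_ncard (Set.finite_of_ncard_pos (by lia))).1 h
  have hnot : ∀ {p q r : E}, p ∈ S → q ∈ S → r ∈ S → p ≠ q → r ≠ q → ¬ Wbtw ℝ p q r := by
    intro p q r hp hq hr hpq hrq hw
    rcases (mem_extremePoints_iff_forall_segment.1 (hS hq)).2 p (hS hp).1 r (hS hr).1
      (mem_segment_iff_wbtw.2 hw) with h | h
    exacts [hpq h, hrq h]
  rcases (hcol.subset (s₁ := {x, y, z}) (by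
    rintro _ (rfl | rfl | rfl)
    exacts [hx, hy, hz])).wbtw_or_wbtw_or_wbtw with hw | hw | hw
  exacts [hnot hx hy hz hxy hyz.symm hw, hnot hy hz hx hyz hxz hw,
    hnot hz hx hy hxz.symm hxy.symm hw]

lemma ncard_vertices_tight_le_two (hE : Module.finrank ℝ E = 2) (hk : l k ≠ 0) :
    {u ∈ vertices (polyhedron l b) | k ∈ tight l b u}.ncard ≤ 2 := by
  have : FiniteDimensional ℝ E := Module.finite_of_finrank_pos (by lia)
  refine ncard_le_two_of_collinear (fun u hu => hu.1) (collinear_iff_finrank_le_one.2 ?_)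
  have hker := Submodule.finrank_mono (vectorSpan_le_ker (g := l k) (c := b k)
    (X := {u ∈ vertices (polyhedron l b) | k ∈ tight l b u}) fun u hu => hu.2)
  have := Module.Dual.finrank_ker_add_one_of_ne_zero hk
  lia

lemma IsIrredundant.exists_vertex {E : Type*} [NormedAddCommGroup E] [NormedSpace ℝ E]
    [FiniteDimensional ℝ E] {l : K → E →ₗ[ℝ] ℝ} (hcomp : IsCompact (polyhedron l b))
    (hk : IsIrredundant l b k) : ∃ u ∈ vertices (polyhedron l b), k ∈ tight l b u := by
  obtain ⟨x, hxk, hx⟩ := hk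
  have hclosed : IsClosed {x | l k x = b k} :=
    isClosed_eq (l k).continuous_of_finiteDimensional continuous_const
  obtain ⟨u, hu⟩ := (hcomp.inter_right hclosed).extremePoints_nonempty
    ⟨x, mem_tightFace_of_forall_lt hxk hx⟩
  exact ⟨u, isExtreme_tightFace.extremePoints_subset_extremePoints hu, hu.1.2⟩

end ExtremePoints

section GeneralPosition

variable {E K : Type*} [AddCommGroup E] [Module ℝ E] {l : K → E →ₗ[ℝ] ℝ} {b : K → ℝ} {x : E}
  {k : K}

/-- The inequalities are in general position: at every point, inside the polyhedron or not, the
tight forms are linearly independent, which is encoded as surjectivity of `tightMap`. -/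
def InGeneralPosition (l : K → E →ₗ[ℝ] ℝ) (b : K → ℝ) : Prop :=
  ∀ x, Function.Surjective (tightMap l b x)

/-- The pairs of vertices that lie on no common facet hyperplane. -/
def disjointPairs (l : K → E →ₗ[ℝ] ℝ) (b : K → ℝ) : Set (E × E) :=
  {q | q.1 ∈ vertices (polyhedron l b) ∧ q.2 ∈ vertices (polyhedron l b) ∧
    Disjoint (tight l b q.1) (tight l b q.2)}

lemma InGeneralPosition.exists_transversal (h : InGeneralPosition l b) (hk : k ∈ tight l b x) :
    ∃ v, l k v ≠ 0 ∧ ∀ k' ∈ tight l b x, k' ≠ k → l k' v = 0 := by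
  classical
  obtain ⟨v, hv⟩ := h x (Pi.single ⟨k, hk⟩ 1)
  refine ⟨v, ?_, fun k' hk' hne => ?_⟩
  · have hkv : l k v = 1 := by simpa [tightMap] using congrFun hv ⟨k, hk⟩
    exact hkv ▸ one_ne_zero
  · simpa [tightMap, hne] using congrFun hv ⟨k', hk'⟩

lemma InGeneralPosition.form_ne_zero_of_mem_tight (h : InGeneralPosition l b)
    (hk : k ∈ tight l b x) : l k ≠ 0 := by
  obtain ⟨v, hv, -⟩ := h.exists_transversal hk
  exact fun h0 => hv (by rw [h0, LinearMap.zero_apply])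

lemma InGeneralPosition.ncard_tight_le [FiniteDimensional ℝ E] [Finite K]
    (h : InGeneralPosition l b) (x : E) : (tight l b x).ncard ≤ Module.finrank ℝ E := by
  have := Fintype.ofFinite (tight l b x)
  simpa using LinearMap.finrank_le_finrank_of_surjective (h x)

lemma InGeneralPosition.ncard_tight_eq [FiniteDimensional ℝ E] [Finite K]
    (h : InGeneralPosition l b) (hx : x ∈ vertices (polyhedron l b)) :
    (tight l b x).ncard = Module.finrank ℝ E :=
  (h.ncard_tight_le x).antisymm (finrank_le_ncard_tight hx)

lemma InGeneralPosition.mem_vertices [FiniteDimensional ℝ E] [Finite K]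
    (h : InGeneralPosition l b) (hx : x ∈ polyhedron l b)
    (hcard : (tight l b x).ncard = Module.finrank ℝ E) : x ∈ vertices (polyhedron l b) := by
  have := Fintype.ofFinite (tight l b x)
  have hfin : Module.finrank ℝ E = Module.finrank ℝ (tight l b x → ℝ) := by simp [← hcard]
  exact mem_vertices_polyhedron_iff.2 ⟨hx, injective_tightMap_iff.1
    ((LinearMap.injective_iff_surjective_of_finrank_eq_finrank hfin).2 (h x))⟩

end GeneralPosition

section CountingVertices

variable {E K : Type*} [NormedAddCommGroup E] [NormedSpace ℝ E] [FiniteDimensional ℝ E] [Finite K]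
  {l : K → E →ₗ[ℝ] ℝ} {b : K → ℝ}

lemma InGeneralPosition.card_le_finrank_mul_ncard_vertices (h : InGeneralPosition l b)
    (hcomp : IsCompact (polyhedron l b)) (hirr : ∀ k, IsIrredundant l b k) :
    Nat.card K ≤ Module.finrank ℝ E * (vertices (polyhedron l b)).ncard := by
  classical
  have := Fintype.ofFinite K
  have hfin : (vertices (polyhedron l b)).Finite := finite_vertices_polyhedron
  have hcover : Finset.univ ⊆ hfin.toFinset.biUnion fun u => (tight l b u).toFinset := by
    intro k _
    obtain ⟨u, hu, hku⟩ := (hirr k).exists_vertex hcomp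
    simpa using ⟨u, hu, hku⟩
  calc Nat.card K = (Finset.univ : Finset K).card := by simp
    _ ≤ _ := Finset.card_le_card hcover
    _ ≤ hfin.toFinset.card * Module.finrank ℝ E :=
      Finset.card_biUnion_le_card_mul _ _ _ fun u _ => by
        rw [← Set.ncard_eq_toFinset_card']
        exact h.ncard_tight_le u
    _ = _ := by rw [mul_comm, Set.ncard_eq_toFinset_card _ hfin]

lemma InGeneralPosition.ncard_vertices_not_disjoint_le (h : InGeneralPosition l b)
    (hE : Module.finrank ℝ E = 2) (u : E) :
    {w ∈ vertices (polyhedron l b) | ¬Disjoint (tight l b u) (tight l b w)}.ncard ≤ 4 := by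
  classical
  have := Fintype.ofFinite K
  have hfin : (vertices (polyhedron l b)).Finite := finite_vertices_polyhedron
  have hcover : {w ∈ vertices (polyhedron l b) | ¬Disjoint (tight l b u) (tight l b w)} ⊆
      (tight l b u).toFinset.biUnion fun k => {w ∈ hfin.toFinset | k ∈ tight l b w} := by
    rintro w ⟨hw, hdisj⟩
    obtain ⟨k, hku, hkw⟩ := Set.not_disjoint_iff.1 hdisj
    simpa using ⟨hw, k, hku, hkw⟩
  have hrow : ∀ k ∈ (tight l b u).toFinset, {w ∈ hfin.toFinset | k ∈ tight l b w}.card ≤ 2 := by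
    intro k hk
    rw [← Set.ncard_coe_finset]
    simpa using ncard_vertices_tight_le_two (b := b) hE
      (h.form_ne_zero_of_mem_tight (Set.mem_toFinset.1 hk))
  have htight := h.ncard_tight_le u
  rw [hE, Set.ncard_eq_toFinset_card'] at htight
  calc _ ≤ _ := (Set.ncard_le_ncard hcover (Finset.finite_toSet _)).trans_eq
        (Set.ncard_coe_finset _)
    _ ≤ (tight l b u).toFinset.card * 2 := Finset.card_biUnion_le_card_mul _ _ _ hrow
    _ ≤ 4 := by lia

lemma InGeneralPosition.sq_ncard_vertices_le (h : InGeneralPosition l b)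
    (hE : Module.finrank ℝ E = 2) :
    (vertices (polyhedron l b)).ncard ^ 2 ≤
      (disjointPairs l b).ncard + 4 * (vertices (polyhedron l b)).ncard := by
  classical
  have hfin : (vertices (polyhedron l b)).Finite := finite_vertices_polyhedron
  set W := hfin.toFinset with hW
  have hcard : (vertices (polyhedron l b)).ncard = W.card := Set.ncard_eq_toFinset_card _ hfin
  have hdisjoint : disjointPairs l b =
      {q ∈ W ×ˢ W | Disjoint (tight l b q.1) (tight l b q.2)} := by
    ext q
    simp [disjointPairs, hW, and_assoc]
  have hmeet : {q ∈ W ×ˢ W | ¬Disjoint (tight l b q.1) (tight l b q.2)} ⊆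
      W.biUnion fun u => {w ∈ W | ¬Disjoint (tight l b u) (tight l b w)}.image (Prod.mk u) := by
    rintro ⟨u, w⟩ huw
    simpa [and_assoc] using huw
  have hmeet_card := (Finset.card_le_card hmeet).trans
    (Finset.card_biUnion_le_card_mul _ _ 4 fun u _ => Finset.card_image_le.trans (by
      rw [← Set.ncard_coe_finset]
      simpa [hW] using h.ncard_vertices_not_disjoint_le hE u))
  have htotal := Finset.card_filter_add_card_filter_not (s := W ×ˢ W)
    (fun q => Disjoint (tight l b q.1) (tight l b q.2))
  rw [Finset.card_product] at htotal
  rw [hdisjoint, Set.ncard_coe_finset, hcard, sq]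
  lia

end CountingVertices

section PointConfigurations

variable {E F κ : Type*} [AddCommGroup E] [Module ℝ E] [AddCommGroup F] [Module ℝ F]
  {p : κ → E} {a b c d : κ}

/-- No two of the lines joining points of the configuration are parallel. -/
def SecantsNotParallel (p : κ → E) : Prop :=
  ∀ a b c d, a ≠ b → c ≠ d → s(a, b) ≠ s(c, d) → LinearIndependent ℝ ![p b - p a, p d - p c]

/-- The affine function `g` measures the height of the points above the line through `p a` and
`p b`, in units of the height of the unique highest point `p c`. -/
structure IsEdgeHeight (p : κ → E) (a b c : κ) (g : E →ᵃ[ℝ] ℝ) : Prop where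
  ne : a ≠ b
  apply_left : g (p a) = 0
  apply_right : g (p b) = 0
  apply_top : g (p c) = 1
  apply_mem_Ioo : ∀ j, j ≠ a → j ≠ b → j ≠ c → g (p j) ∈ Ioo 0 1

lemma eq_zero_of_linearIndependent_pair (hE : Module.finrank ℝ E = 2) {x y : E}
    (hxy : LinearIndependent ℝ ![x, y]) {f : E →ₗ[ℝ] F} (hx : f x = 0) (hy : f y = 0) :
    f = 0 := by
  have : FiniteDimensional ℝ E := Module.finite_of_finrank_pos (by lia)
  refine LinearMap.ext_on_range (hxy.span_eq_top_of_card_eq_finrank' (by simp [hE])) fun i => ?_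
  fin_cases i
  exacts [hx, hy]

namespace SecantsNotParallel

lemma mk_eq_mk (hp : SecantsNotParallel p) (hE : Module.finrank ℝ E = 2) {g : E →ₗ[ℝ] ℝ}
    (hg : g ≠ 0) (hab : a ≠ b) (hcd : c ≠ d) (hgab : g (p a) = g (p b))
    (hgcd : g (p c) = g (p d)) : s(a, b) = s(c, d) := by
  by_contra hne
  exact hg (eq_zero_of_linearIndependent_pair hE (hp a b c d hab hcd hne)
    (by rw [map_sub, hgab, sub_self]) (by rw [map_sub, hgcd, sub_self]))

lemma linearIndependent_triple (hp : SecantsNotParallel p) (hab : a ≠ b) (hac : a ≠ c)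
    (hbc : b ≠ c) : LinearIndependent ℝ ![p b - p a, p c - p a] :=
  hp a b a c hab hac (by simp [hbc, hac])

lemma affineMap_eq_zero (hp : SecantsNotParallel p) (hE : Module.finrank ℝ E = 2)
    (hab : a ≠ b) (hac : a ≠ c) (hbc : b ≠ c) {f : E →ᵃ[ℝ] F} (ha : f (p a) = 0)
    (hb : f (p b) = 0) (hc : f (p c) = 0) : f = 0 := by
  have hlinear : ∀ x, f.linear (x - p a) = f x := fun x => by
    simpa [ha] using f.linearMap_vsub x (p a)
  have hzero : f.linear = 0 :=
    eq_zero_of_linearIndependent_pair hE (hp.linearIndependent_triple hab hac hbc)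
      (by rw [hlinear, hb]) (by rw [hlinear, hc])
  ext x
  rw [← hlinear, hzero]
  rfl

lemma affineSpan_eq_top (hp : SecantsNotParallel p) (hE : Module.finrank ℝ E = 2)
    (hab : a ≠ b) (hac : a ≠ c) (hbc : b ≠ c) : affineSpan ℝ (range p) = ⊤ := by
  have : FiniteDimensional ℝ E := Module.finite_of_finrank_pos (by lia)
  have hsub : ∀ j, p j - p a ∈ vectorSpan ℝ (range p) :=
    fun j => vsub_mem_vectorSpan ℝ (mem_range_self j) (mem_range_self a)
  rw [AffineSubspace.affineSpan_eq_top_iff_vectorSpan_eq_top_of_nonempty ℝ E E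
      ⟨p a, mem_range_self a⟩,
    eq_top_iff, ← (hp.linearIndependent_triple hab hac hbc).span_eq_top_of_card_eq_finrank'
      (by simp [hE]), Submodule.span_le]
  rintro _ ⟨i, rfl⟩
  fin_cases i
  exacts [hsub b, hsub c]

end SecantsNotParallel

lemma exists_supporting_secant [Finite κ] [Nontrivial κ] (hE : 2 ≤ Module.finrank ℝ E)
    (p : κ → E) :
    ∃ (g : E →ₗ[ℝ] ℝ) (a b : κ), g ≠ 0 ∧ a ≠ b ∧ g (p a) = g (p b) ∧ ∀ j, g (p a) ≤ g (p j) := by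
  classical
  have := Fintype.ofFinite κ
  have : FiniteDimensional ℝ E := Module.finite_of_finrank_pos (by lia)
  have : Nontrivial E := Module.nontrivial_of_finrank_pos (R := ℝ) (by lia)
  obtain ⟨q, hq⟩ := exists_ne (0 : Module.Dual ℝ E)
  obtain ⟨a, ha⟩ := Finite.exists_min fun j => q (p j)
  by_cases hb : ∃ b, a ≠ b ∧ q (p a) = q (p b)
  · obtain ⟨b, hab, hqb⟩ := hb
    exact ⟨q, a, b, hq, hab, hqb, ha⟩
  have hpos : ∀ j, j ≠ a → 0 < q (p j - p a) := fun j hj => by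
    rw [map_sub, sub_pos]
    exact (ha j).lt_of_ne fun h => hb ⟨j, hj.symm, h⟩
  obtain ⟨k, hk⟩ : ∃ k : Module.Dual ℝ E, ∀ r : ℝ, r • q ≠ k := by
    by_contra! hspan
    have := finrank_le_one q hspan
    rw [Subspace.dual_finrank_eq] at this
    lia
  obtain ⟨j₀, hj₀⟩ := exists_ne a
  obtain ⟨b, hb, hmax⟩ := Finset.exists_max_image (Finset.univ.erase a)
    (fun j => k (p j - p a) / q (p j - p a)) ⟨j₀, by simpa using hj₀⟩
  have hba := Finset.ne_of_mem_erase hb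
  -- Tilting `q` around `p a` by the extremal slope `r` makes the minimum attained at `b` as well.
  set r := k (p b - p a) / q (p b - p a)
  have hgsub : ∀ j, (r • q - k) (p j) - (r • q - k) (p a) =
      r * q (p j - p a) - k (p j - p a) := fun j => by
    simp only [LinearMap.sub_apply, LinearMap.smul_apply, map_sub, smul_eq_mul]
    ring
  refine ⟨r • q - k, a, b, sub_ne_zero.2 (hk r), hba.symm, ?_, fun j => ?_⟩
  · rw [← sub_eq_zero, ← neg_sub, hgsub, div_mul_cancel₀ _ (hpos b hba).ne', sub_self, neg_zero]
  · rcases eq_or_ne j a with rfl | hja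
    · rfl
    · rw [← sub_nonneg, hgsub, sub_nonneg, ← div_le_iff₀ (hpos j hja)]
      exact hmax j (by simpa using hja)

lemma exists_ne_ne_of_three_le_card [Fintype κ] (hκ : 3 ≤ Fintype.card κ) (a b : κ) :
    ∃ c, c ≠ a ∧ c ≠ b := by
  classical
  obtain ⟨c, -, hc⟩ := Finset.exists_mem_notMem_of_card_lt_card
    (s := {a, b}) (t := Finset.univ) (Finset.card_le_two.trans_lt (by rwa [Finset.card_univ]))
  exact ⟨c, by simpa using hc⟩

lemma SecantsNotParallel.exists_isEdgeHeight [Fintype κ] (hp : SecantsNotParallel p)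
    (hE : Module.finrank ℝ E = 2) (hκ : 3 ≤ Fintype.card κ) :
    ∃ (a b c : κ) (g : E →ᵃ[ℝ] ℝ), IsEdgeHeight p a b c g := by
  have : Nontrivial κ := Fintype.one_lt_card_iff_nontrivial.1 (by lia)
  obtain ⟨G, a, b, hG, hab, hGab, hmin⟩ := exists_supporting_secant hE.ge p
  have hpos : ∀ j, j ≠ a → j ≠ b → G (p a) < G (p j) := fun j hja hjb =>
    (hmin j).lt_of_ne fun h => by
      have := hp.mk_eq_mk hE hG hab hja.symm hGab h
      simp [hjb.symm, hja.symm] at this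
  obtain ⟨c, hmax⟩ := Finite.exists_max fun j => G (p j)
  obtain ⟨j₀, hj₀a, hj₀b⟩ := exists_ne_ne_of_three_le_card hκ a b
  have hac : 0 < G (p c) - G (p a) := sub_pos.2 ((hpos j₀ hj₀a hj₀b).trans_le (hmax j₀))
  let g : E →ᵃ[ℝ] ℝ :=
    ((G (p c) - G (p a))⁻¹ • G).toAffineMap -
      AffineMap.const ℝ E ((G (p c) - G (p a))⁻¹ * G (p a))
  have hg : ∀ x, g x = (G x - G (p a)) / (G (p c) - G (p a)) := fun x => by
    have : g x = (G (p c) - G (p a))⁻¹ * G x - (G (p c) - G (p a))⁻¹ * G (p a) := rfl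
    rw [this]
    ring
  refine ⟨a, b, c, g, hab, ?_, ?_, ?_, fun j hja hjb hjc => ⟨?_, ?_⟩⟩
  · rw [hg, sub_self, zero_div]
  · rw [hg, hGab, sub_self, zero_div]
  · rw [hg, div_self hac.ne']
  · rw [hg]
    exact div_pos (sub_pos.2 (hpos j hja hjb)) hac
  · rw [hg, div_lt_one hac, sub_lt_sub_iff_right]
    refine (hmax j).lt_of_ne fun h => ?_
    have := hp.mk_eq_mk hE hG hab hjc hGab h
    simp [hja.symm, hjb.symm] at this

end PointConfigurations

section Hom

variable {E E' K κ : Type*} [AddCommGroup E] [Module ℝ E] [AddCommGroup E'] [Module ℝ E']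
  {p : κ → E} {l : K → E' →ₗ[ℝ] ℝ} {b : K → ℝ} {f : E →ᵃ[ℝ] E'}

/-- The linear form `f ↦ l k (f (p j))` on affine maps, indexed by `(k, j)`. The hom-polytope is cut
out by the inequalities `homForm p l (k, j) f ≤ b k`, so its bounds are written `b ∘ Prod.fst`. -/
def homForm (p : κ → E) (l : K → E' →ₗ[ℝ] ℝ) (e : K × κ) : (E →ᵃ[ℝ] E') →ₗ[ℝ] ℝ where
  toFun f := l e.1 (f (p e.2))
  map_add' f g := by simp
  map_smul' c f := by simp

lemma homForm_apply (e : K × κ) : homForm p l e f = l e.1 (f (p e.2)) := rfl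

lemma mem_tight_homForm {e : K × κ} :
    e ∈ tight (homForm p l) (b ∘ Prod.fst) f ↔ e.1 ∈ tight l b (f (p e.2)) := Iff.rfl

lemma mem_polyhedron_homForm :
    f ∈ polyhedron (homForm p l) (b ∘ Prod.fst) ↔ ∀ j, f (p j) ∈ polyhedron l b :=
  ⟨fun h j k => h (k, j), fun h e => h e.2 e.1⟩

lemma homPolytope_convexHull_polyhedron :
    homPolytope (convexHull ℝ (range p)) (polyhedron l b) =
      polyhedron (homForm p l) (b ∘ Prod.fst) := by
  ext f
  rw [mem_polyhedron_homForm, homPolytope, mem_ofPred_eq, mapsTo_iff_subset_preimage,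
    (convex_polyhedron.affine_preimage f).convexHull_subset_iff, range_subset_iff]
  rfl

lemma homForm_const_lt {x₀ : E'} (h₀ : ∀ k, l k x₀ < b k) (e : K × κ) :
    homForm p l e (AffineMap.const ℝ E x₀) < (b ∘ Prod.fst) e :=
  h₀ e.1

end Hom

section SimpleVertices

variable {E E' K κ : Type*} [AddCommGroup E] [Module ℝ E] [AddCommGroup E'] [Module ℝ E']
  {p : κ → E} {l : K → E' →ₗ[ℝ] ℝ} {b : K → ℝ} {a a' c : κ} {g : E →ᵃ[ℝ] ℝ} {u w : E'}

namespace IsEdgeHeight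

lemma left_ne_top (hg : IsEdgeHeight p a a' c g) : a ≠ c := by
  rintro rfl
  exact zero_ne_one (hg.apply_left.symm.trans hg.apply_top)

lemma right_ne_top (hg : IsEdgeHeight p a a' c g) : a' ≠ c := by
  rintro rfl
  exact zero_ne_one (hg.apply_right.symm.trans hg.apply_top)

lemma lineMap_left (hg : IsEdgeHeight p a a' c g) :
    (AffineMap.lineMap u w).comp g (p a) = u := by
  rw [AffineMap.comp_apply, hg.apply_left, AffineMap.lineMap_apply_zero]

lemma lineMap_right (hg : IsEdgeHeight p a a' c g) :
    (AffineMap.lineMap u w).comp g (p a') = u := by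
  rw [AffineMap.comp_apply, hg.apply_right, AffineMap.lineMap_apply_zero]

lemma lineMap_top (hg : IsEdgeHeight p a a' c g) :
    (AffineMap.lineMap u w).comp g (p c) = w := by
  rw [AffineMap.comp_apply, hg.apply_top, AffineMap.lineMap_apply_one]

lemma apply_mem_Icc (hg : IsEdgeHeight p a a' c g) (j : κ) : g (p j) ∈ Icc 0 1 := by
  by_cases hja : j = a
  · simp [hja, hg.apply_left]
  by_cases hja' : j = a'
  · simp [hja', hg.apply_right]
  by_cases hjc : j = c
  · simp [hjc, hg.apply_top]
  exact Ioo_subset_Icc_self (hg.apply_mem_Ioo j hja hja' hjc)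

lemma lineMap_mem_polyhedron (hg : IsEdgeHeight p a a' c g) (hu : u ∈ polyhedron l b)
    (hw : w ∈ polyhedron l b) :
    (AffineMap.lineMap u w).comp g ∈ polyhedron (homForm p l) (b ∘ Prod.fst) :=
  mem_polyhedron_homForm.2 fun j => convex_polyhedron.lineMap_mem hu hw (hg.apply_mem_Icc j)

lemma tight_lineMap (hg : IsEdgeHeight p a a' c g) (hu : u ∈ polyhedron l b)
    (hw : w ∈ polyhedron l b) (hdisj : Disjoint (tight l b u) (tight l b w)) :
    tight (homForm p l) (b ∘ Prod.fst) ((AffineMap.lineMap u w).comp g) =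
      tight l b u ×ˢ {a, a'} ∪ tight l b w ×ˢ {c} := by
  ext ⟨k, j⟩
  simp only [mem_tight_homForm, mem_union, mem_prod, mem_insert_iff, mem_singleton_iff]
  by_cases hja : j = a
  · rw [hja, hg.lineMap_left]
    simp [hg.left_ne_top]
  by_cases hja' : j = a'
  · rw [hja', hg.lineMap_right]
    simp [hg.right_ne_top]
  by_cases hjc : j = c
  · rw [hjc, hg.lineMap_top]
    simp [hg.left_ne_top.symm, hg.right_ne_top.symm]
  rw [AffineMap.comp_apply, HomPolytope.tight_lineMap hu hw (hg.apply_mem_Ioo j hja hja' hjc),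
    hdisj.inter_eq]
  simp [hja, hja', hjc]

lemma lineMap_mem_vertices [Finite K] [Finite κ] (hg : IsEdgeHeight p a a' c g)
    (hp : SecantsNotParallel p) (hE : Module.finrank ℝ E = 2) (hu : u ∈ vertices (polyhedron l b))
    (hw : w ∈ vertices (polyhedron l b)) :
    (AffineMap.lineMap u w).comp g ∈ vertices (polyhedron (homForm p l) (b ∘ Prod.fst)) := by
  rw [mem_vertices_polyhedron_iff] at hu hw ⊢
  refine ⟨hg.lineMap_mem_polyhedron hu.1 hw.1, fun v hv => ?_⟩
  have hzero : ∀ {j x}, (∀ y, (∀ k ∈ tight l b x, l k y = 0) → y = 0) →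
      (AffineMap.lineMap u w).comp g (p j) = x → v (p j) = 0 := fun {j x} hsep hx =>
    hsep _ fun k hk => hv (k, j) (mem_tight_homForm.2 (hx ▸ hk))
  exact hp.affineMap_eq_zero hE hg.ne hg.left_ne_top hg.right_ne_top
    (hzero hu.2 hg.lineMap_left) (hzero hu.2 hg.lineMap_right) (hzero hw.2 hg.lineMap_top)

end IsEdgeHeight

lemma ncard_disjointPairs_le_ncard_simpleVertices [FiniteDimensional ℝ E'] [Finite K] [Fintype κ]
    {x₀ : E'} (h₀ : ∀ k, l k x₀ < b k) (hl : InGeneralPosition l b) (hp : SecantsNotParallel p)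
    (hE : Module.finrank ℝ E = 2) (hκ : 3 ≤ Fintype.card κ) :
    (disjointPairs l b).ncard ≤
      (simpleVertices (polyhedron (homForm p l) (b ∘ Prod.fst))).ncard := by
  have : FiniteDimensional ℝ E := Module.finite_of_finrank_pos (by lia)
  obtain ⟨a, a', c, g, hg⟩ := hp.exists_isEdgeHeight hE hκ
  refine Set.ncard_le_ncard_of_injOn (fun q => (AffineMap.lineMap q.1 q.2).comp g) ?_ ?_
    (finite_vertices_polyhedron.subset fun f hf => hf.1)
  · rintro ⟨u, w⟩ ⟨hu, hw, hdisj⟩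
    refine mem_simpleVertices_of_ncard_tight_eq (homForm_const_lt h₀)
      (hg.lineMap_mem_vertices hp hE hu hw) ?_
    rw [hg.tight_lineMap hu.1 hw.1 hdisj, Set.ncard_union_eq (disjoint_prod.2 (.inl hdisj)),
      Set.ncard_prod, Set.ncard_prod, Set.ncard_pair hg.ne, Set.ncard_singleton,
      hl.ncard_tight_eq hu, hl.ncard_tight_eq hw, AffineMap.finrank_eq, hE]
    ring
  · rintro ⟨u, w⟩ - ⟨u', w'⟩ - h
    have happly := fun j => congrArg (fun f : E →ᵃ[ℝ] E' => f (p j)) h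
    refine Prod.ext ?_ ?_
    · simpa only [hg.lineMap_left] using happly a
    · simpa only [hg.lineMap_top] using happly c

end SimpleVertices

section CollapsedVertices

variable {E E' K κ : Type*} [AddCommGroup E] [Module ℝ E] [AddCommGroup E'] [Module ℝ E']
  {p : κ → E} {l : K → E' →ₗ[ℝ] ℝ} {b : K → ℝ} {f : E →ᵃ[ℝ] E'} {φ : E →ₗ[ℝ] ℝ} {k : K}

lemma InGeneralPosition.ncard_tight_image_tightFace_le [FiniteDimensional ℝ E'] [Finite K]
    (hl : InGeneralPosition l b) (hE' : Module.finrank ℝ E' = 2) (k : K) :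
    (tight l b '' tightFace l b k).ncard ≤ 3 := by
  rcases (tightFace l b k).eq_empty_or_nonempty with hempty | ⟨x₁, -, hx₁⟩
  · simp [hempty]
  let W := {u ∈ vertices (polyhedron l b) | k ∈ tight l b u}
  have hW : W.ncard ≤ 2 := ncard_vertices_tight_le_two hE' (hl.form_ne_zero_of_mem_tight hx₁)
  have hsub : tight l b '' tightFace l b k ⊆ insert {k} (tight l b '' W) := by
    rintro _ ⟨x, ⟨hx, hxk⟩, rfl⟩
    by_cases h : (tight l b x).ncard ≤ 1
    · refine .inl ?_
      exact eq_singleton_iff_unique_mem.2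
        ⟨hxk, fun k' hk' => (Set.ncard_le_one_iff (Set.toFinite _)).1 h hk' hxk⟩
    · refine .inr ⟨x, ⟨hl.mem_vertices hx ?_, hxk⟩, rfl⟩
      have := hl.ncard_tight_le x
      lia
  have himage := Set.ncard_image_le (f := tight l b)
    (finite_vertices_polyhedron.subset (sep_subset _ _) : W.Finite)
  have hinsert := Set.ncard_insert_le {k} (tight l b '' W)
  have := Set.ncard_le_ncard hsub (Set.toFinite _)
  lia

lemma InGeneralPosition.ncard_vertices_common_tight_le [FiniteDimensional ℝ E'] [Finite K]
    [Fintype κ] (hl : InGeneralPosition l b) (hE' : Module.finrank ℝ E' = 2) :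
    {f ∈ vertices (polyhedron (homForm p l) (b ∘ Prod.fst)) |
      ∃ k, ∀ j, k ∈ tight l b (f (p j))}.ncard ≤ Nat.card K * 3 ^ Fintype.card κ := by
  classical
  have := Fintype.ofFinite K
  let D : K → Finset (Set K) := fun k => (Set.toFinite (tight l b '' tightFace l b k)).toFinset
  have hD : ∀ k, (D k).card ≤ 3 := fun k => by
    rw [← Set.ncard_eq_toFinset_card]
    exact hl.ncard_tight_image_tightFace_le hE' k
  let B : Finset (κ → Set K) := Finset.univ.biUnion fun k => Fintype.piFinset fun _ => D k
  have hB : B.card ≤ Nat.card K * 3 ^ Fintype.card κ := by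
    rw [Nat.card_eq_fintype_card]
    refine Finset.card_biUnion_le_card_mul _ _ _ fun k _ => ?_
    rw [Fintype.card_piFinset, Finset.prod_const]
    exact Nat.pow_le_pow_left (hD k) _
  refine le_trans ?_ hB
  rw [← Set.ncard_coe_finset]
  refine Set.ncard_le_ncard_of_injOn (fun f j => tight l b (f (p j))) ?_ ?_ (Finset.finite_toSet _)
  · rintro f ⟨hf, k, hk⟩
    have hmem := mem_polyhedron_homForm.1 hf.1
    simp only [B, D, Finset.mem_coe, Finset.mem_biUnion, Fintype.mem_piFinset,
      Set.Finite.mem_toFinset]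
    exact ⟨k, Finset.mem_univ k, fun j => ⟨f (p j), ⟨hmem j, hk j⟩, rfl⟩⟩
  · rintro f ⟨hf, -⟩ f' ⟨hf', -⟩ h
    refine injOn_tight_vertices hf hf' (Set.ext fun e => ?_)
    have he : tight l b (f (p e.2)) = tight l b (f' (p e.2)) := congrFun h e.2
    rw [mem_tight_homForm, mem_tight_homForm, he]

lemma InGeneralPosition.ncard_tight_homForm_le [FiniteDimensional ℝ E'] [Finite K] [Finite κ]
    (hl : InGeneralPosition l b) {J : Set κ}
    (hJ : ∀ e ∈ tight (homForm p l) (b ∘ Prod.fst) f, e.2 ∈ J) :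
    (tight (homForm p l) (b ∘ Prod.fst) f).ncard ≤ Module.finrank ℝ E' * J.ncard := by
  classical
  have := Fintype.ofFinite K
  have := Fintype.ofFinite κ
  rw [Set.ncard_eq_toFinset_card', Set.ncard_eq_toFinset_card' J]
  refine Finset.card_le_mul_card_image_of_maps_to (f := Prod.snd)
    (fun e he => by simpa using hJ e (by simpa using he)) _ fun j _ => ?_
  refine le_trans ?_ (hl.ncard_tight_le (f (p j)))
  rw [Set.ncard_eq_toFinset_card']
  refine Finset.card_le_card_of_injOn Prod.fst ?_ ?_
  · rintro ⟨k, j'⟩ he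
    obtain ⟨hk, rfl⟩ : (k, j') ∈ tight (homForm p l) (b ∘ Prod.fst) f ∧ j' = j := by
      simpa using he
    simpa using mem_tight_homForm.1 hk
  · rintro ⟨k, j'⟩ he ⟨k', j''⟩ he' hkk'
    have hj' : j' = j := (Finset.mem_filter.1 (Finset.mem_coe.1 he)).2
    have hj'' : j'' = j := (Finset.mem_filter.1 (Finset.mem_coe.1 he')).2
    exact Prod.ext hkk' (hj'.trans hj''.symm)

namespace SecantsNotParallel

lemma ncard_fiber_le_two (hp : SecantsNotParallel p) (hE : Module.finrank ℝ E = 2) [Finite κ]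
    (hφ : φ ≠ 0) (s : ℝ) : {j | φ (p j) = s}.ncard ≤ 2 := by
  by_contra! h
  obtain ⟨i, hi, j, hj, k, hk, hij, hik, hjk⟩ := (Set.two_lt_ncard (Set.toFinite _)).1 h
  have := hp.mk_eq_mk hE hφ hij hik (hi.trans hj.symm) (hi.trans hk.symm)
  simp [hjk, hik] at this

lemma ncard_two_fibers_le_three (hp : SecantsNotParallel p) (hE : Module.finrank ℝ E = 2)
    [Finite κ] (hφ : φ ≠ 0) {s t : ℝ} (hst : s ≠ t) :
    {j | φ (p j) = s ∨ φ (p j) = t}.ncard ≤ 3 := by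
  have hunion : {j | φ (p j) = s ∨ φ (p j) = t} = {j | φ (p j) = s} ∪ {j | φ (p j) = t} := rfl
  have hs := hp.ncard_fiber_le_two hE hφ s
  have ht := hp.ncard_fiber_le_two hE hφ t
  have hle := Set.ncard_union_le {j | φ (p j) = s} {j | φ (p j) = t}
  rw [hunion]
  by_contra! h
  obtain ⟨i, hi, i', hi', hii'⟩ :=
    (Set.one_lt_ncard (Set.toFinite _)).1 (by lia : 1 < {j | φ (p j) = s}.ncard)
  obtain ⟨j, hj, j', hj', hjj'⟩ :=
    (Set.one_lt_ncard (Set.toFinite _)).1 (by lia : 1 < {j | φ (p j) = t}.ncard)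
  have hne : ∀ {x y : κ}, φ (p x) = s → φ (p y) = t → x ≠ y := by
    rintro x _ hx hy rfl
    exact hst (hx.symm.trans hy)
  have := hp.mk_eq_mk hE hφ hii' hjj' (hi.trans hi'.symm) (hj.trans hj'.symm)
  simp [hne hi hj, hne hi hj'] at this

end SecantsNotParallel

lemma exists_ker_le_ker_of_not_injective (hE : Module.finrank ℝ E = 2) {A : E →ₗ[ℝ] E'}
    (hA : ¬Function.Injective A) :
    ∃ φ : E →ₗ[ℝ] ℝ, φ ≠ 0 ∧ LinearMap.ker φ ≤ LinearMap.ker A := by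
  have : FiniteDimensional ℝ E := Module.finite_of_finrank_pos (by lia)
  rw [← LinearMap.ker_eq_bot, Submodule.eq_bot_iff] at hA
  push Not at hA
  obtain ⟨v, hv, hv0⟩ := hA
  have hspan := finrank_span_singleton (K := ℝ) hv0
  obtain ⟨φ, hφ, hle⟩ := Submodule.exists_le_ker_of_lt_top (ℝ ∙ v)
    (lt_top_iff_ne_top.2 fun h => by rw [h, finrank_top] at hspan; lia)
  have hker := Module.Dual.finrank_ker_add_one_of_ne_zero hφ
  refine ⟨φ, hφ, ?_⟩
  rw [← Submodule.eq_of_le_of_finrank_eq hle (by lia)]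
  exact (Submodule.span_singleton_le_iff_mem v _).2 hv

lemma apply_eq_lineMap_of_ker_le_ker (hker : LinearMap.ker φ ≤ LinearMap.ker f.linear) {u w : E}
    (huw : φ u ≠ φ w) (x : E) :
    f x = AffineMap.lineMap (f u) (f w) ((φ x - φ u) / (φ w - φ u)) := by
  rw [← AffineMap.apply_lineMap, ← sub_eq_zero, ← vsub_eq_sub, ← f.linearMap_vsub, vsub_eq_sub]
  refine hker ?_
  rw [LinearMap.mem_ker, AffineMap.lineMap_apply_module', map_sub, map_add, map_smul, map_sub,
    smul_eq_mul, div_mul_cancel₀ _ (sub_ne_zero.2 huw.symm), sub_add_cancel, sub_self]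

lemma exists_common_tight_of_not_injective [FiniteDimensional ℝ E'] [Finite K] [Fintype κ]
    (hl : InGeneralPosition l b) (hp : SecantsNotParallel p) (hE : Module.finrank ℝ E = 2)
    (hκ : 3 ≤ Fintype.card κ) (hf : f ∈ polyhedron (homForm p l) (b ∘ Prod.fst))
    (hcard : Module.finrank ℝ E' * 3 < (tight (homForm p l) (b ∘ Prod.fst) f).ncard)
    (hinj : ¬Function.Injective f.linear) : ∃ k, ∀ j, k ∈ tight l b (f (p j)) := by
  obtain ⟨φ, hφ, hker⟩ := exists_ker_le_ker_of_not_injective hE hinj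
  have : Nonempty κ := Fintype.card_pos_iff.1 (by lia)
  obtain ⟨i, hi⟩ := Finite.exists_min fun j => φ (p j)
  obtain ⟨i', hi'⟩ := Finite.exists_max fun j => φ (p j)
  have hlt : φ (p i) < φ (p i') := by
    refine (hi i').lt_of_ne fun h => ?_
    have huniv : {j | φ (p j) = φ (p i)} = univ :=
      eq_univ_of_forall fun j => le_antisymm (h ▸ hi' j) (hi j)
    have := hp.ncard_fiber_le_two hE hφ (φ (p i))
    rw [huniv, Set.ncard_univ, Nat.card_eq_fintype_card] at this
    lia
  have hmem := mem_polyhedron_homForm.1 hf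
  have hsegment := fun j => apply_eq_lineMap_of_ker_le_ker hker hlt.ne (p j)
  suffices (tight l b (f (p i)) ∩ tight l b (f (p i'))).Nonempty by
    obtain ⟨k, hk⟩ := this
    exact ⟨k, fun j => hsegment j ▸ inter_subset_tight_lineMap _ hk⟩
  by_contra! hempty
  have hextreme : ∀ e ∈ tight (homForm p l) (b ∘ Prod.fst) f,
      e.2 ∈ {j | φ (p j) = φ (p i) ∨ φ (p j) = φ (p i')} := by
    rintro ⟨k, j⟩ he
    by_contra! hj
    have hs : (φ (p j) - φ (p i)) / (φ (p i') - φ (p i)) ∈ Ioo (0 : ℝ) 1 := by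
      have hpos := sub_pos.2 hlt
      refine ⟨div_pos (sub_pos.2 ((hi j).lt_of_ne' fun h => hj (.inl h))) hpos, ?_⟩
      rw [div_lt_one hpos, sub_lt_sub_iff_right]
      exact (hi' j).lt_of_ne fun h => hj (.inr h)
    have hk := mem_tight_homForm.1 he
    rw [hsegment, tight_lineMap (hmem i) (hmem i') hs, hempty] at hk
    exact hk
  have := hl.ncard_tight_homForm_le hextreme
  have := Nat.mul_le_mul_left (Module.finrank ℝ E') (hp.ncard_two_fibers_le_three hE hφ hlt.ne)
  lia

end CollapsedVertices

section SeparatingForms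

variable {V T ι : Type*} [AddCommGroup V] [Module ℝ V] {ψ : T → V →ₗ[ℝ] ℝ} {β : T → ℝ} {f : V}

/-- Only the zero vector is annihilated by all the forms `ψ t`. -/
def IsSeparating (ψ : T → V →ₗ[ℝ] ℝ) : Prop := ∀ v, (∀ t, ψ t v = 0) → v = 0

/-- The matrix whose rows are the coordinate vectors of the forms `ψ t` in the basis `B`. -/
noncomputable def formMatrix (B : Module.Basis ι ℝ V) (ψ : T → V →ₗ[ℝ] ℝ) : Matrix T ι ℝ :=
  Matrix.of fun t i => ψ t (B i)

/-- The forms `(v, c) ↦ ψ t v + β t * c`, which turn the affine system `ψ t v = β t` into a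
homogeneous one. -/
def homogenization (ψ : T → V →ₗ[ℝ] ℝ) (β : T → ℝ) (t : T) : V × ℝ →ₗ[ℝ] ℝ :=
  (ψ t).coprod (β t • LinearMap.id)

lemma homogenization_apply (t : T) (y : V × ℝ) :
    homogenization ψ β t y = ψ t y.1 + β t * y.2 := rfl

lemma formMatrix_mulVec_repr [Fintype ι] (B : Module.Basis ι ℝ V) (v : V) (t : T) :
    (formMatrix B ψ).mulVec (B.repr v) t = ψ t v := by
  conv_rhs => rw [← B.sum_repr v, map_sum]
  simp only [Matrix.mulVec, dotProduct, formMatrix, Matrix.of_apply, map_smul, smul_eq_mul,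
    mul_comm]

lemma det_formMatrix_ne_zero_iff [Fintype ι] [DecidableEq ι] {φ : ι → V →ₗ[ℝ] ℝ}
    (B : Module.Basis ι ℝ V) : (formMatrix B φ).det ≠ 0 ↔ IsSeparating φ := by
  rw [not_iff_comm, ← Matrix.exists_mulVec_eq_zero_iff, IsSeparating]
  push Not
  refine ⟨fun ⟨v, hv, hne⟩ => ⟨B.repr v, ?_, ?_⟩, fun ⟨c, hne, hc⟩ => ?_⟩
  · simpa [DFunLike.coe_fn_eq] using hne
  · exact funext fun t => (formMatrix_mulVec_repr B v t).trans (hv t)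
  · refine ⟨B.equivFun.symm c, fun t => ?_, (map_ne_zero_iff _ B.equivFun.symm.injective).2 hne⟩
    rw [← formMatrix_mulVec_repr B, ← B.equivFun_apply, LinearEquiv.apply_symm_apply, hc]
    rfl

lemma IsSeparating.exists_subfamily [Finite T] [Finite ι] (hψ : IsSeparating ψ)
    (B : Module.Basis ι ℝ V) : ∃ s : ι → T, IsSeparating (ψ ∘ s) := by
  have := Fintype.ofFinite ι
  have : FiniteDimensional ℝ V := B.finiteDimensional_of_finite
  obtain ⟨κ, a, ha, hspan, hli⟩ := exists_linearIndependent' ℝ ψ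
  have := Finite.of_injective a ha
  have := Fintype.ofFinite κ
  have hsep : IsSeparating (ψ ∘ a) := fun v hv => hψ v fun t => by
    have hle : Submodule.span ℝ (range (ψ ∘ a)) ≤ LinearMap.ker (LinearMap.applyₗ v) :=
      Submodule.span_le.2 (range_subset_iff.2 hv)
    exact hle (hspan ▸ Submodule.subset_span (mem_range_self t))
  have hinj : Function.Injective (LinearMap.pi (ψ ∘ a)) :=
    LinearMap.ker_eq_bot.1 (LinearMap.ker_eq_bot'.2 fun v hv => hsep v (congrFun hv))
  have hcard : Fintype.card κ = Fintype.card ι := by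
    refine le_antisymm ?_ ?_
    · simpa [Module.finrank_eq_card_basis B] using hli.fintype_card_le_finrank
    · simpa [Module.finrank_eq_card_basis B] using
        LinearMap.finrank_le_finrank_of_injective hinj
  let e := Fintype.equivOfCardEq hcard
  exact ⟨a ∘ e.symm, fun v hv => hsep v fun k => by simpa using hv (e k)⟩

lemma IsSeparating.eventually [Finite ι] {X : Type*} [TopologicalSpace X] {x₀ : X}
    {φ : X → ι → V →ₗ[ℝ] ℝ} (hφ : IsSeparating (φ x₀)) (B : Module.Basis ι ℝ V)
    (hcont : ∀ i v, Continuous fun x => φ x i v) : ∀ᶠ x in 𝓝 x₀, IsSeparating (φ x) := by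
  classical
  have := Fintype.ofFinite ι
  have hdet : Continuous fun x => (formMatrix B (φ x)).det :=
    (continuous_matrix fun i q => hcont i (B q)).matrix_det
  simpa only [det_formMatrix_ne_zero_iff] using
    hdet.continuousAt.eventually_ne ((det_formMatrix_ne_zero_iff B).2 hφ)

lemma not_isSeparating_homogenization (hf : ∀ t, ψ t f = β t) :
    ¬IsSeparating (homogenization ψ β) := fun h => by
  have hzero := h (f, -1) fun t => by simp [homogenization_apply, hf]
  simpa using congrArg Prod.snd hzero

lemma isSeparating_homogenization {s : ι → T} {t : T} (hs : IsSeparating (ψ ∘ s))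
    (hf : ∀ i, ψ (s i) f = β (s i)) (ht : ψ t f ≠ β t) :
    IsSeparating (homogenization ψ β ∘ Sum.elim s (Function.const Unit t)) := by
  intro ⟨v, c⟩ h
  have hv : v + c • f = 0 := hs _ fun i => by
    simpa [homogenization_apply, hf, mul_comm] using h (.inl i)
  have hc : c * (β t - ψ t f) = 0 := by
    have hvt : ψ t v + c * ψ t f = 0 := by simpa using congrArg (ψ t) hv
    have htt : ψ t v + β t * c = 0 := h (.inr ())
    linear_combination htt - hvt
  obtain rfl : c = 0 := (mul_eq_zero.1 hc).resolve_right (sub_ne_zero.2 ht.symm)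
  simpa using hv

end SeparatingForms

section Perturbation

variable {E E' K κ ι : Type*} [AddCommGroup E] [Module ℝ E] [AddCommGroup E'] [Module ℝ E']
  {p : κ → E} {l : K → E' →ₗ[ℝ] ℝ} {b : K → ℝ} {f : E →ᵃ[ℝ] E'}

lemma homForm_update [DecidableEq κ] (j : κ) (d : E) (t : ℝ) (e : K × κ) (g : E →ᵃ[ℝ] E') :
    homForm (Function.update p j (p j + t • d)) l e g =
      homForm p l e g + t * if e.2 = j then l e.1 (g.linear d) else 0 := by
  obtain ⟨k, j'⟩ := e
  by_cases hj : j' = j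
  · subst hj
    rw [homForm_apply, Function.update_self, add_comm, ← vadd_eq_add, g.map_vadd]
    simp [homForm_apply, add_comm]
  · simp [homForm_apply, hj]

/-- Choose some tight pairs that pin `f` down, and one more, `(k, j)`. Moving `p j` so that
`f (p j)` leaves the hyperplane of row `k` along all the other hyperplanes that are tight there
preserves the chosen equations but breaks that of `(k, j)`. -/
lemma exists_isSeparating_homogenization_of_surjective [Finite K] [Finite κ] [Fintype ι]
    (B : Module.Basis ι ℝ (E →ᵃ[ℝ] E')) (hl : InGeneralPosition l b)
    (hf : f ∈ vertices (polyhedron (homForm p l) (b ∘ Prod.fst)))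
    (hcard : Fintype.card ι < (tight (homForm p l) (b ∘ Prod.fst) f).ncard)
    (hsurj : Function.Surjective f.linear) :
    ∃ S : ι ⊕ Unit → K × κ, (∀ o, S o ∈ tight (homForm p l) (b ∘ Prod.fst) f) ∧
      ∃ p' : κ → E, IsSeparating (homogenization (homForm p' l) (b ∘ Prod.fst) ∘ S) := by
  classical
  set T := tight (homForm p l) (b ∘ Prod.fst) f
  obtain ⟨s, hs⟩ := IsSeparating.exists_subfamily (ψ := fun e : T => homForm p l e)
    (fun v hv => (mem_vertices_polyhedron_iff.1 hf).2 v fun e he => hv ⟨e, he⟩) B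
  obtain ⟨⟨k, j⟩, hkT, hks⟩ : ∃ e ∈ T, e ∉ range fun i => (s i : K × κ) := by
    refine Set.exists_mem_notMem_of_ncard_lt_ncard (lt_of_le_of_lt ?_ hcard)
    simpa [← image_univ] using Set.ncard_image_le (f := fun i => (s i : K × κ)) finite_univ
  obtain ⟨d', hkd, hd⟩ := hl.exists_transversal (x := f (p j)) hkT
  obtain ⟨d, rfl⟩ := hsurj d'
  let move : ℝ → κ → E := fun t => Function.update p j (p j + t • d)
  have hs₀ : IsSeparating fun i => homForm (move 0) l (s i) := by
    simpa [move, Function.comp_def] using hs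
  obtain ⟨t, ht, ht₀⟩ : ∃ t, IsSeparating (fun i => homForm (move t) l (s i)) ∧ t ≠ 0 :=
    (((hs₀.eventually (φ := fun t i => homForm (move t) l (s i)) B fun i g => by
      simp only [move, homForm_update]
      fun_prop).filter_mono nhdsWithin_le_nhds).and
        (self_mem_nhdsWithin (s := {(0 : ℝ)}ᶜ))).exists
  refine ⟨Sum.elim (fun i => s i) (Function.const Unit (k, j)),
    Sum.rec (fun i => (s i).2) fun _ => hkT, move t,
    isSeparating_homogenization (f := f) ht (fun i => ?_) ?_⟩
  · have hzero : (if (s i : K × κ).2 = j then l (s i : K × κ).1 (f.linear d) else 0) = 0 := by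
      refine ite_eq_right_iff.2 fun hj => hd _ ?_ fun hk => hks ⟨i, Prod.ext hk hj⟩
      exact hj ▸ mem_tight_homForm.1 (s i).2
    rw [homForm_update, hzero, mul_zero, add_zero]
    exact (s i).2
  · rw [homForm_update, if_pos rfl, mem_tight.1 hkT]
    simpa using ⟨ht₀, hkd⟩

end Perturbation

section GeneralPositionOfSeparating

variable {E K ι : Type*} [AddCommGroup E] [Module ℝ E] {l : K → E →ₗ[ℝ] ℝ} {b : K → ℝ}

lemma inGeneralPosition_of_isSeparating [Finite K] [Fintype ι] (B : Module.Basis ι ℝ E)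
    (hK : Fintype.card ι ≤ Nat.card K) (hlin : ∀ S : ι ↪ K, IsSeparating (l ∘ S))
    (haff : ∀ S : ι ⊕ Unit ↪ K, IsSeparating (homogenization l b ∘ S)) :
    InGeneralPosition l b := by
  classical
  have := Fintype.ofFinite K
  have : FiniteDimensional ℝ E := B.finiteDimensional_of_finite
  intro x y
  have hcard : (tight l b x).toFinset.card ≤ Fintype.card ι := by
    by_contra! hlt
    obtain ⟨S⟩ : Nonempty (ι ⊕ Unit ↪ tight l b x) :=
      Function.Embedding.nonempty_of_card_le (by simpa using hlt)
    exact not_isSeparating_homogenization (ψ := l ∘ Subtype.val ∘ S) (β := b ∘ Subtype.val ∘ S)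
      (fun o => (S o).2) (haff (S.trans (Function.Embedding.subtype _)))
  obtain ⟨s, hs, hsι⟩ := Finset.exists_superset_card_eq hcard (by simpa using hK)
  let e : ι ≃ s := Fintype.equivOfCardEq (by simpa using hsι.symm)
  have hinj : Function.Injective (LinearMap.pi fun i => l (e i)) :=
    LinearMap.ker_eq_bot.1 (LinearMap.ker_eq_bot'.2 fun v hv =>
      hlin (e.toEmbedding.trans (Function.Embedding.subtype _)) v (congrFun hv))
  have hsurj := (LinearMap.injective_iff_surjective_of_finrank_eq_finrank (by
    simp [Module.finrank_eq_card_basis B])).1 hinj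
  obtain ⟨v, hv⟩ := hsurj fun i => if h : (e i : K) ∈ tight l b x then y ⟨e i, h⟩ else 0
  refine ⟨v, funext fun k => ?_⟩
  have hks : (k : K) ∈ s := hs (mem_toFinset.2 k.2)
  simpa [tightMap] using congrFun hv (e.symm ⟨k, hks⟩)

end GeneralPositionOfSeparating

section PolynomialFunctions

variable {Z : Type*} {D : Z → ℝ} {S : Set (Z → ℝ)}

/-- The points at which none of the functions in `S` vanishes, apart from the zero function. -/
def genericSet (S : Set (Z → ℝ)) : Set Z := {z | ∀ D ∈ S, D ≠ 0 → D z ≠ 0}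

lemma apply_ne_zero_of_mem_genericSet {z z' : Z} (hz : z ∈ genericSet S) (hD : D ∈ S)
    (hz' : D z' ≠ 0) : D z ≠ 0 :=
  hz D hD (Function.ne_iff.2 ⟨z', hz'⟩)

lemma genericSet_eq_sInter : genericSet S = ⋂₀ ((fun D => {z | D z ≠ 0}) '' (S \ {0})) := by
  ext z
  simp [genericSet]

variable [AddCommGroup Z] [Module ℝ Z]

variable (Z) in
/-- The algebra of polynomial functions on `Z`, generated by the linear forms. -/
def polynomialFunctions : Subalgebra ℝ (Z → ℝ) :=
  Algebra.adjoin ℝ (range fun g : Module.Dual ℝ Z => (g : Z → ℝ))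

lemma linear_mem_polynomialFunctions (g : Z →ₗ[ℝ] ℝ) :
    (fun z => g z) ∈ polynomialFunctions Z :=
  Algebra.subset_adjoin (mem_range_self g)

lemma const_mem_polynomialFunctions (c : ℝ) : (fun _ => c) ∈ polynomialFunctions Z :=
  (polynomialFunctions Z).algebraMap_mem c

lemma sum_mem_polynomialFunctions {T : Type*} [Fintype T] {A : Z → T → ℝ}
    (hA : ∀ t, (fun z => A z t) ∈ polynomialFunctions Z) :
    (fun z => ∑ t, A z t) ∈ polynomialFunctions Z := by
  simpa only [← Finset.sum_fn] using sum_mem (t := Finset.univ) fun t _ => hA t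

lemma det_mem_polynomialFunctions {T : Type*} [Fintype T] [DecidableEq T] {A : Z → Matrix T T ℝ}
    (hA : ∀ i j, (fun z => A z i j) ∈ polynomialFunctions Z) :
    (fun z => (A z).det) ∈ polynomialFunctions Z := by
  have hdet : (fun z => (A z).det) = ∑ σ : Equiv.Perm T,
      (Equiv.Perm.sign σ : ℤ) • ∏ i, fun z => A z (σ i) i := by
    ext z
    simp [Matrix.det_apply, Units.smul_def]
  rw [hdet]
  exact sum_mem fun σ _ => zsmul_mem (prod_mem fun i _ => hA _ _) _

lemma exists_polynomial_eval_lineMap (hD : D ∈ polynomialFunctions Z) (x y : Z) :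
    ∃ q : Polynomial ℝ, ∀ t : ℝ, D (AffineMap.lineMap x y t) = q.eval t := by
  induction hD using Algebra.adjoin_induction with
  | mem D hD =>
    obtain ⟨g, rfl⟩ := hD
    exact ⟨Polynomial.C (g (y - x)) * Polynomial.X + Polynomial.C (g x), fun t => by
      simp [AffineMap.lineMap_apply, mul_comm]⟩
  | algebraMap c => exact ⟨Polynomial.C c, by simp⟩
  | add D D' _ _ ih ih' =>
    obtain ⟨q, hq⟩ := ih
    obtain ⟨q', hq'⟩ := ih'
    exact ⟨q + q', by simp [hq, hq']⟩
  | mul D D' _ _ ih ih' =>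
    obtain ⟨q, hq⟩ := ih
    obtain ⟨q', hq'⟩ := ih'
    exact ⟨q * q', by simp [hq, hq']⟩

variable [TopologicalSpace Z] [IsTopologicalAddGroup Z] [ContinuousSMul ℝ Z]

lemma dense_ne_zero_of_mem_polynomialFunctions (hD : D ∈ polynomialFunctions Z) (hne : D ≠ 0) :
    Dense {z | D z ≠ 0} := by
  obtain ⟨y, hy⟩ := Function.ne_iff.1 hne
  intro x
  obtain ⟨q, hq⟩ := exists_polynomial_eval_lineMap hD x y
  have hq₀ : q ≠ 0 := by
    rintro rfl
    simpa using hy ((by simpa using hq 1 : D y = 0))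
  have hdense : Dense {t : ℝ | q.eval t = 0}ᶜ :=
    (Polynomial.finite_setOfPred_isRoot hq₀).countable.dense_compl ℝ
  have hline : Continuous fun t : ℝ => AffineMap.lineMap x y t := AffineMap.lineMap_continuous
  have hx := hline.continuousWithinAt.mem_closure_image (hdense 0)
  rw [AffineMap.lineMap_apply_zero] at hx
  refine closure_mono ?_ hx
  rintro _ ⟨t, ht, rfl⟩
  simpa [hq] using ht

variable [T2Space Z] [FiniteDimensional ℝ Z]

lemma continuous_of_mem_polynomialFunctions (hD : D ∈ polynomialFunctions Z) : Continuous D := by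
  induction hD using Algebra.adjoin_induction with
  | mem D hD =>
    obtain ⟨g, rfl⟩ := hD
    exact g.continuous_of_finiteDimensional
  | algebraMap c => exact continuous_const
  | add D D' _ _ ih ih' => exact ih.add ih'
  | mul D D' _ _ ih ih' => exact ih.mul ih'

lemma isOpen_genericSet (hfin : S.Finite) (hS : S ⊆ polynomialFunctions Z) :
    IsOpen (genericSet S) := by
  rw [genericSet_eq_sInter]
  refine (hfin.sdiff.image _).isOpen_sInter ?_
  rintro _ ⟨D, ⟨hD, -⟩, rfl⟩
  exact isOpen_ne_fun (continuous_of_mem_polynomialFunctions (hS hD)) continuous_const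

lemma dense_genericSet (hfin : S.Finite) (hS : S ⊆ polynomialFunctions Z) :
    Dense (genericSet S) := by
  rw [genericSet_eq_sInter]
  refine (hfin.sdiff.image _).dense_sInter ?_ ?_
  · rintro _ ⟨D, ⟨hD, -⟩, rfl⟩
    exact isOpen_ne_fun (continuous_of_mem_polynomialFunctions (hS hD)) continuous_const
  · rintro _ ⟨D, ⟨hD, hne⟩, rfl⟩
    exact dense_ne_zero_of_mem_polynomialFunctions (hS hD) hne

end PolynomialFunctions

section GenericMatrices

/-- The pairs `(M, M')` of a `d × m` matrix of columns and an `n × e` matrix of rows. -/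
abbrev MatrixPair (d m n e : ℕ) : Type :=
  Matrix (Fin d) (Fin m) ℝ × Matrix (Fin n) (Fin e) ℝ

variable {d e m n : ℕ}

/-- The forms whose bounds `rowForm M' k x ≤ 1` define `rowPolyhedron M'`. -/
def rowForm (M' : Matrix (Fin n) (Fin e) ℝ) (k : Fin n) : (Fin e → ℝ) →ₗ[ℝ] ℝ :=
  LinearMap.proj k ∘ₗ M'.mulVecLin

lemma rowForm_apply (M' : Matrix (Fin n) (Fin e) ℝ) (k : Fin n) (x : Fin e → ℝ) :
    rowForm M' k x = M' k ⬝ᵥ x := rfl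

lemma rowPolyhedron_eq_polyhedron (M' : Matrix (Fin n) (Fin e) ℝ) :
    rowPolyhedron M' = polyhedron (rowForm M') 1 := rfl

lemma homPolytope_colPolytope_rowPolyhedron (M : Matrix (Fin d) (Fin m) ℝ)
    (M' : Matrix (Fin n) (Fin e) ℝ) : homPolytope (colPolytope M) (rowPolyhedron M') =
      polyhedron (homForm M.col (rowForm M')) ((1 : Fin n → ℝ) ∘ Prod.fst) :=
  homPolytope_convexHull_polyhedron (p := M.col) (l := rowForm M') (b := 1)

/-- The basis of `V × ℝ` in which the matrices of homogenized forms on `V` are written. -/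
noncomputable def homogeneousBasis {V ι : Type*} [AddCommGroup V] [Module ℝ V]
    (B : Module.Basis ι ℝ V) : Module.Basis (ι ⊕ Unit) ℝ (V × ℝ) :=
  B.prod (Module.Basis.singleton Unit ℝ)

/-- The determinant of two secant vectors of the columns of `z.1`. -/
def secantDet (q : Fin m × Fin m × Fin m × Fin m) (z : MatrixPair 2 m n 2) : ℝ :=
  (Matrix.of ![z.1.col q.2.1 - z.1.col q.1, z.1.col q.2.2.2 - z.1.col q.2.2.1]).det

/-- The determinant of two rows of `z.2`. -/
noncomputable def rowDet (S : Fin 2 → Fin n) (z : MatrixPair 2 m n 2) : ℝ :=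
  (formMatrix (Pi.basisFun ℝ (Fin 2)) (rowForm z.2 ∘ S)).det

/-- The determinant of the augmented matrix of three equations `rowForm z.2 k x = 1`, which vanishes
if they have a common solution. -/
noncomputable def augmentedRowDet (S : Fin 2 ⊕ Unit → Fin n) (z : MatrixPair 2 m n 2) : ℝ :=
  (formMatrix (homogeneousBasis (Pi.basisFun ℝ (Fin 2))) (homogenization (rowForm z.2) 1 ∘ S)).det

/-- The determinant of the augmented matrix of seven equations `rowForm z.2 k (f (z.1.col j)) = 1`,
which vanishes if they have a common solution `f`. -/
noncomputable def augmentedHomDet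
    (S : Fin (Module.finrank ℝ ((Fin 2 → ℝ) →ᵃ[ℝ] (Fin 2 → ℝ))) ⊕ Unit → Fin n × Fin m)
    (z : MatrixPair 2 m n 2) : ℝ :=
  (formMatrix (homogeneousBasis (Module.finBasis ℝ ((Fin 2 → ℝ) →ᵃ[ℝ] (Fin 2 → ℝ))))
    (homogenization (homForm z.1.col (rowForm z.2)) 1 ∘ S)).det

/-- The polynomials whose non-vanishing, where possible, is the notion of genericity for pairs of
polygons. -/
def genericPolynomials (m n : ℕ) : Set (MatrixPair 2 m n 2 → ℝ) :=
  range secantDet ∪ range rowDet ∪ range augmentedRowDet ∪ range augmentedHomDet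

lemma finite_genericPolynomials : (genericPolynomials m n).Finite :=
  (((finite_range _).union (finite_range _)).union (finite_range _)).union (finite_range _)

lemma fst_apply_mem_polynomialFunctions (i : Fin d) (j : Fin m) :
    (fun z : MatrixPair d m n e => z.1 i j) ∈
      polynomialFunctions (MatrixPair d m n e) :=
  linear_mem_polynomialFunctions (Matrix.entryLinearMap ℝ ℝ i j ∘ₗ
    LinearMap.fst ℝ (Matrix (Fin d) (Fin m) ℝ) (Matrix (Fin n) (Fin e) ℝ))

lemma snd_apply_mem_polynomialFunctions (k : Fin n) (i : Fin e) :
    (fun z : MatrixPair d m n e => z.2 k i) ∈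
      polynomialFunctions (MatrixPair d m n e) :=
  linear_mem_polynomialFunctions (Matrix.entryLinearMap ℝ ℝ k i ∘ₗ
    LinearMap.snd ℝ (Matrix (Fin d) (Fin m) ℝ) (Matrix (Fin n) (Fin e) ℝ))

lemma rowForm_mem_polynomialFunctions
    {w : MatrixPair d m n e → Fin e → ℝ}
    (hw : ∀ i, (fun z => w z i) ∈ polynomialFunctions _) (k : Fin n) :
    (fun z => rowForm z.2 k (w z)) ∈ polynomialFunctions _ :=
  sum_mem_polynomialFunctions fun i => mul_mem (snd_apply_mem_polynomialFunctions k i) (hw i)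

lemma homForm_mem_polynomialFunctions (q : Fin n × Fin m)
    (f : (Fin d → ℝ) →ᵃ[ℝ] (Fin e → ℝ)) :
    (fun z : MatrixPair d m n e =>
      homForm z.1.col (rowForm z.2) q f) ∈ polynomialFunctions _ := by
  refine rowForm_mem_polynomialFunctions (fun i => ?_) q.1
  have hdecomp : (fun z : MatrixPair d m n e =>
      f (z.1.col q.2) i) = fun z => ∑ r, LinearMap.toMatrix' f.linear i r * z.1 r q.2 + f 0 i := by
    ext z
    have happly : f (z.1.col q.2) = f.linear (z.1.col q.2) + f 0 := congrFun f.decomp _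
    rw [happly, ← LinearMap.toMatrix'_mulVec]
    rfl
  rw [hdecomp]
  exact add_mem (sum_mem_polynomialFunctions fun r => mul_mem (const_mem_polynomialFunctions _)
    (fst_apply_mem_polynomialFunctions r q.2)) (const_mem_polynomialFunctions _)

lemma det_formMatrix_mem_polynomialFunctions {Z V ι : Type*} [AddCommGroup Z]
    [Module ℝ Z] [AddCommGroup V] [Module ℝ V] [Fintype ι] [DecidableEq ι]
    {φ : Z → ι → V →ₗ[ℝ] ℝ} (B : Module.Basis ι ℝ V)
    (hφ : ∀ i v, (fun z => φ z i v) ∈ polynomialFunctions Z) :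
    (fun z => (formMatrix B (φ z)).det) ∈ polynomialFunctions Z :=
  det_mem_polynomialFunctions fun i j => hφ i (B j)

lemma homogenization_mem_polynomialFunctions {Z V T : Type*} [AddCommGroup Z] [Module ℝ Z]
    [AddCommGroup V] [Module ℝ V] {ψ : Z → T → V →ₗ[ℝ] ℝ} {β : T → ℝ}
    (hψ : ∀ t v, (fun z => ψ z t v) ∈ polynomialFunctions Z) (t : T) (y : V × ℝ) :
    (fun z => homogenization (ψ z) β t y) ∈ polynomialFunctions Z :=
  add_mem (hψ t y.1) (const_mem_polynomialFunctions (β t * y.2))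

lemma genericPolynomials_subset :
    genericPolynomials m n ⊆ (polynomialFunctions (MatrixPair 2 m n 2) : Set _) := by
  have hrow : ∀ k v, (fun z : MatrixPair 2 m n 2 =>
      rowForm z.2 k v) ∈ polynomialFunctions _ := fun k v =>
    rowForm_mem_polynomialFunctions (fun i => const_mem_polynomialFunctions (v i)) k
  have hsecant : ∀ a b i, (fun z : MatrixPair 2 m n 2 => (z.1.col b - z.1.col a) i) ∈
      polynomialFunctions _ := fun a b i =>
    sub_mem (fst_apply_mem_polynomialFunctions i b) (fst_apply_mem_polynomialFunctions i a)
  rintro _ (((⟨⟨a, b, c, d⟩, rfl⟩ | ⟨S, rfl⟩) | ⟨S, rfl⟩) | ⟨S, rfl⟩)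
  · refine det_mem_polynomialFunctions fun i j => ?_
    fin_cases i
    · exact hsecant a b j
    · exact hsecant c d j
  · exact det_formMatrix_mem_polynomialFunctions _ fun i v => hrow (S i) v
  · exact det_formMatrix_mem_polynomialFunctions _ fun o =>
      homogenization_mem_polynomialFunctions hrow (S o)
  · exact det_formMatrix_mem_polynomialFunctions _ fun o =>
      homogenization_mem_polynomialFunctions homForm_mem_polynomialFunctions (S o)

end GenericMatrices

section GenericPairs

variable {m n : ℕ} {z : MatrixPair 2 m n 2}

lemma secantDet_ne_zero_iff {a b c d : Fin m} : secantDet (a, b, c, d) z ≠ 0 ↔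
    LinearIndependent ℝ ![z.1.col b - z.1.col a, z.1.col d - z.1.col c] := by
  rw [← isUnit_iff_ne_zero, secantDet, ← Matrix.isUnit_iff_isUnit_det,
    ← Matrix.linearIndependent_rows_iff_isUnit]
  rfl

lemma rowDet_ne_zero_iff {S : Fin 2 → Fin n} :
    rowDet S z ≠ 0 ↔ IsSeparating (rowForm z.2 ∘ S) :=
  det_formMatrix_ne_zero_iff _

lemma augmentedRowDet_ne_zero_iff {S : Fin 2 ⊕ Unit → Fin n} :
    augmentedRowDet S z ≠ 0 ↔ IsSeparating (homogenization (rowForm z.2) 1 ∘ S) :=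
  det_formMatrix_ne_zero_iff _

lemma augmentedHomDet_ne_zero_iff
    {S : Fin (Module.finrank ℝ ((Fin 2 → ℝ) →ᵃ[ℝ] (Fin 2 → ℝ))) ⊕ Unit → Fin n × Fin m} :
    augmentedHomDet S z ≠ 0 ↔
      IsSeparating (homogenization (homForm z.1.col (rowForm z.2)) 1 ∘ S) :=
  det_formMatrix_ne_zero_iff _

lemma secantsNotParallel_of_mem_genericSet (hz : z ∈ genericSet (genericPolynomials m n)) :
    SecantsNotParallel z.1.col := by
  intro a b c d hab hcd hne
  let y : Fin m → ℕ := fun j => if j = a ∨ j = b then 0 else j + 1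
  have hy : y d ≠ y c := by
    have hne' : ¬((c = a ∨ c = b) ∧ (d = a ∨ d = b)) := by grind
    grind
  let M : Matrix (Fin 2) (Fin m) ℝ := .of ![Pi.single b 1, fun j => y j]
  have hM : secantDet (a, b, c, d) ((M, 0) : MatrixPair 2 m n 2) ≠ 0 := by
    have hya : y a = 0 := if_pos (.inl rfl)
    have hyb : y b = 0 := if_pos (.inr rfl)
    simpa [secantDet, Matrix.det_fin_two, M, hya, hyb, hab, sub_eq_zero] using hy
  exact secantDet_ne_zero_iff.1
    (apply_ne_zero_of_mem_genericSet hz (.inl (.inl (.inl (mem_range_self _)))) hM)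

lemma isSeparating_rowForm_of_mem_genericSet (hz : z ∈ genericSet (genericPolynomials m n))
    (S : Fin 2 ↪ Fin n) : IsSeparating (rowForm z.2 ∘ S) := by
  let M' : Matrix (Fin n) (Fin 2) ℝ := .of (Function.extend S (fun i => Pi.single i 1) 0)
  have hrow : ∀ i, M' (S i) = Pi.single i 1 := fun i =>
    S.injective.extend_apply (fun i => Pi.single i 1) 0 i
  have hM' : rowDet S ((0, M') : MatrixPair 2 m n 2) ≠ 0 :=
    rowDet_ne_zero_iff.2 fun v hv => funext fun i => show v i = 0 by
      simpa only [Function.comp_apply, rowForm_apply, hrow, single_one_dotProduct] using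
        hv i
  exact rowDet_ne_zero_iff.1
    (apply_ne_zero_of_mem_genericSet hz (.inl (.inl (.inr (mem_range_self _)))) hM')

lemma isSeparating_homogenization_rowForm_of_mem_genericSet
    (hz : z ∈ genericSet (genericPolynomials m n)) (S : Fin 2 ⊕ Unit ↪ Fin n) :
    IsSeparating (homogenization (rowForm z.2) 1 ∘ S) := by
  let M' : Matrix (Fin n) (Fin 2) ℝ :=
    .of (Function.extend S (Sum.elim (fun i => Pi.single i 1) 0) 0)
  have hrow : ∀ o, M' (S o) = Sum.elim (fun i => Pi.single i 1) 0 o := fun o =>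
    S.injective.extend_apply _ _ o
  have hM' : augmentedRowDet S ((0, M') : MatrixPair 2 m n 2) ≠ 0 := by
    refine augmentedRowDet_ne_zero_iff.2 fun ⟨v, c⟩ hv => ?_
    simp only [Function.comp_apply, homogenization_apply, rowForm_apply, hrow] at hv
    obtain rfl : c = 0 := by simpa using hv (.inr ())
    obtain rfl : v = 0 := funext fun i => show v i = 0 by
      simpa only [Sum.elim_inl, single_one_dotProduct, mul_zero, add_zero] using hv (.inl i)
    rfl
  exact augmentedRowDet_ne_zero_iff.1
    (apply_ne_zero_of_mem_genericSet hz (.inl (.inr (mem_range_self _))) hM')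

lemma inGeneralPosition_of_mem_genericSet (hz : z ∈ genericSet (genericPolynomials m n))
    (hn : 2 ≤ n) : InGeneralPosition (rowForm z.2) 1 :=
  inGeneralPosition_of_isSeparating (Pi.basisFun ℝ (Fin 2)) (by simpa using hn)
    (isSeparating_rowForm_of_mem_genericSet hz)
    (isSeparating_homogenization_rowForm_of_mem_genericSet hz)

lemma not_injective_linear_of_mem_genericSet (hz : z ∈ genericSet (genericPolynomials m n))
    (hn : 2 ≤ n) {f : (Fin 2 → ℝ) →ᵃ[ℝ] (Fin 2 → ℝ)}
    (hf : f ∈ vertices (polyhedron (homForm z.1.col (rowForm z.2)) ((1 : Fin n → ℝ) ∘ Prod.fst)))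
    (hcard : Module.finrank ℝ ((Fin 2 → ℝ) →ᵃ[ℝ] (Fin 2 → ℝ)) <
      (tight (homForm z.1.col (rowForm z.2)) ((1 : Fin n → ℝ) ∘ Prod.fst) f).ncard) :
    ¬Function.Injective f.linear := by
  intro hinj
  obtain ⟨S, hS, p, hp⟩ := exists_isSeparating_homogenization_of_surjective (Module.finBasis ℝ _)
    (inGeneralPosition_of_mem_genericSet hz hn) hf (by simpa using hcard)
    (LinearMap.injective_iff_surjective.1 hinj)
  have hdet : augmentedHomDet S ((.of fun i j => p j i, z.2) : MatrixPair 2 m n 2) ≠ 0 :=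
    augmentedHomDet_ne_zero_iff.2 hp
  refine not_isSeparating_homogenization (f := f) hS (augmentedHomDet_ne_zero_iff.1
    (apply_ne_zero_of_mem_genericSet hz (.inr (mem_range_self _)) hdet))

end GenericPairs

section OpenConditions

lemma convexIndependent_iff_exists_dual {ι E : Type*} [Finite ι] [NormedAddCommGroup E]
    [NormedSpace ℝ E] {p : ι → E} : ConvexIndependent ℝ p ↔
      ∀ j, ∃ g : StrongDual ℝ E, ∀ k, k ≠ j → g (p j) < g (p k) := by
  rw [convexIndependent_iff_notMem_convexHull_sdiff]
  constructor
  · intro h j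
    obtain ⟨g, u, hju, hu⟩ := geometric_hahn_banach_point_closed (convex_convexHull ℝ _)
      (((toFinite (univ \ {j})).image p).isCompact_convexHull ℝ).isClosed (h j univ)
    exact ⟨g, fun k hk => hju.trans (hu _ (subset_convexHull ℝ _ ⟨k, by simpa using hk, rfl⟩))⟩
  · intro h j s hmem
    obtain ⟨g, hg⟩ := h j
    have hhull : convexHull ℝ (p '' (s \ {j})) ⊆ {x | g (p j) < g x} := by
      refine convexHull_min ?_ (convex_halfSpace_gt g.toLinearMap.isLinear _)
      rintro _ ⟨k, hk, rfl⟩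
      exact hg k hk.2
    exact lt_irrefl (g (p j)) (hhull hmem)

lemma isOpen_setOf_convexIndependent {ι E : Type*} [Finite ι] [NormedAddCommGroup E]
    [NormedSpace ℝ E] : IsOpen {p : ι → E | ConvexIndependent ℝ p} := by
  simp only [convexIndependent_iff_exists_dual, ofPred_forall, ofPred_exists]
  exact isOpen_iInter_of_finite fun j => isOpen_iUnion fun g => isOpen_iInter_of_finite fun k =>
    isOpen_iInter_of_finite fun _ => isOpen_lt (by fun_prop) (by fun_prop)

lemma isCompact_polyhedron_iff {E K : Type*} [NormedAddCommGroup E] [NormedSpace ℝ E]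
    [FiniteDimensional ℝ E] {l : K → E →ₗ[ℝ] ℝ} {b : K → ℝ} (hb : ∀ k, 0 ≤ b k) :
    IsCompact (polyhedron l b) ↔
      ∃ ρ > 0, ∀ x ∈ Metric.sphere (0 : E) ρ, ∃ k, b k < l k x := by
  have := FiniteDimensional.proper_real E
  constructor
  · intro hcompact
    obtain ⟨ρ, hρ, hsub⟩ := hcompact.isBounded.subset_ball_lt 0 0
    refine ⟨ρ, hρ, fun x hx => ?_⟩
    by_contra! hx'
    exact (mem_ball_zero_iff.1 (hsub hx')).ne (mem_sphere_zero_iff_norm.1 hx)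
  · rintro ⟨ρ, hρ, hsphere⟩
    have hclosed : IsClosed (polyhedron l b) := polyhedron_eq_iInter (l := l) ▸ isClosed_iInter
      fun k => isClosed_le (l k).continuous_of_finiteDimensional continuous_const
    refine Metric.isCompact_of_isClosed_isBounded hclosed
      (Metric.isBounded_closedBall.subset fun x hx => mem_closedBall_zero_iff.2 (?_ : ‖x‖ ≤ ρ))
    by_contra! hlt
    have hx₀ : 0 < ‖x‖ := hρ.trans hlt
    have hs : (ρ / ‖x‖) • x ∈ polyhedron l b :=
      convex_polyhedron.smul_mem_of_zero_mem (fun k => by simpa using hb k) hx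
        ⟨by positivity, (div_le_one hx₀).2 hlt.le⟩
    obtain ⟨k, hk⟩ := hsphere ((ρ / ‖x‖) • x) (by
      simp [norm_smul, abs_of_pos hρ, hx₀.ne'])
    exact hk.not_ge (hs k)

lemma isIrredundant_one_iff {E K : Type*} [AddCommGroup E] [Module ℝ E] {l : K → E →ₗ[ℝ] ℝ}
    {k : K} : IsIrredundant l 1 k ↔ ∃ x, 0 < l k x ∧ ∀ k', k' ≠ k → l k' x < l k x := by
  constructor
  · rintro ⟨x, hx, hlt⟩
    exact ⟨x, hx ▸ zero_lt_one, fun k' hk' => hx ▸ hlt k' hk'⟩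
  · rintro ⟨x, hx, hlt⟩
    refine ⟨(l k x)⁻¹ • x, ?_, fun k' hk' => ?_⟩
    · simp [hx.ne']
    · simpa [inv_mul_eq_div, div_lt_one hx] using hlt k' hk'

variable {e n : ℕ}

lemma rowForm_zero_lt_one (M' : Matrix (Fin n) (Fin e) ℝ) (k : Fin n) :
    rowForm M' k 0 < (1 : Fin n → ℝ) k := by
  simp

lemma mem_rowRealizations_iff {M' : Matrix (Fin n) (Fin e) ℝ} : M' ∈ rowRealizations e n ↔
    IsCompact (polyhedron (rowForm M') 1) ∧ ∀ k, IsIrredundant (rowForm M') 1 k := by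
  have h₀ := rowForm_zero_lt_one M'
  rw [← encard_facets_eq_iff h₀, rowRealizations, mem_ofPred_eq, rowPolyhedron_eq_polyhedron,
    dim_polyhedron h₀]
  simp

lemma continuous_rowForm (k : Fin n) :
    Continuous fun q : Matrix (Fin n) (Fin e) ℝ × (Fin e → ℝ) => rowForm q.1 k q.2 := by
  simp only [rowForm_apply, dotProduct]
  fun_prop

lemma isOpen_setOf_isCompact_polyhedron_rowForm :
    IsOpen {M' : Matrix (Fin n) (Fin e) ℝ | IsCompact (polyhedron (rowForm M') 1)} := by
  refine isOpen_iff_eventually.2 fun M' hM' => ?_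
  obtain ⟨ρ, hρ, hsphere⟩ := (isCompact_polyhedron_iff fun _ => zero_le_one).1 hM'
  have hnear : ∀ᶠ M'' in 𝓝 M', ∀ x ∈ Metric.sphere (0 : Fin e → ℝ) ρ, ∃ k, 1 < rowForm M'' k x :=
    (isCompact_sphere 0 ρ).eventually_forall_of_forall_eventually fun x hx => by
      obtain ⟨k, hk⟩ := hsphere x hx
      filter_upwards [(continuous_rowForm k).continuousAt.eventually_const_lt hk] with q hq
      exact ⟨k, hq⟩
  filter_upwards [hnear] with M'' hM''
  exact (isCompact_polyhedron_iff fun _ => zero_le_one).2 ⟨ρ, hρ, hM''⟩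

lemma isOpen_rowRealizations : IsOpen (rowRealizations e n) := by
  have hcont : ∀ k x, Continuous fun M' : Matrix (Fin n) (Fin e) ℝ => rowForm M' k x :=
    fun k x => (continuous_rowForm k).comp (.prodMk_left x)
  have hirr : IsOpen {M' : Matrix (Fin n) (Fin e) ℝ | ∀ k, IsIrredundant (rowForm M') 1 k} := by
    simp only [isIrredundant_one_iff, ofPred_forall, ofPred_exists, ofPred_and]
    exact isOpen_iInter_of_finite fun k => isOpen_iUnion fun x =>
      (isOpen_lt continuous_const (hcont k x)).inter (isOpen_iInter_of_finite fun k' =>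
        isOpen_iInter_of_finite fun _ => isOpen_lt (hcont k' x) (hcont k x))
  convert isOpen_setOf_isCompact_polyhedron_rowForm.inter hirr
  ext M'
  exact mem_rowRealizations_iff

end OpenConditions

section SimpleRatio

variable {m n : ℕ} {z : MatrixPair 2 m n 2}

/-- The pairs of an `m`-gon and an `n`-gon that are generic in the sense of
`genericPolynomials`. -/
def genericPairs (m n : ℕ) : Set (MatrixPair 2 m n 2) :=
  ({M | ConvexIndependent ℝ M.col} ×ˢ rowRealizations 2 n) ∩ genericSet (genericPolynomials m n)

lemma isOpen_convexIndependent_prod_rowRealizations : IsOpen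
    ({M : Matrix (Fin 2) (Fin m) ℝ | ConvexIndependent ℝ M.col} ×ˢ rowRealizations 2 n) := by
  have hcol : Continuous fun M : Matrix (Fin 2) (Fin m) ℝ => M.col :=
    continuous_pi fun j => continuous_pi fun i => continuous_id.matrix_elem i j
  exact (isOpen_setOf_convexIndependent.preimage hcol).prod isOpen_rowRealizations

lemma genericPairs_subset (hm : 3 ≤ m) :
    genericPairs m n ⊆ colRealizations 2 m ×ˢ rowRealizations 2 n := by
  rintro z ⟨⟨hconv, hrow⟩, hgen⟩
  let a : Fin m := ⟨0, by lia⟩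
  obtain ⟨b, hba, -⟩ := exists_ne_ne_of_three_le_card (by simpa using hm) a a
  obtain ⟨c, hca, hcb⟩ := exists_ne_ne_of_three_le_card (by simpa using hm) a b
  exact ⟨⟨hconv, (secantsNotParallel_of_mem_genericSet hgen).affineSpan_eq_top (by simp) hba.symm
    hca.symm hcb.symm⟩, hrow⟩

lemma isOpen_genericPairs : IsOpen (genericPairs m n) :=
  isOpen_convexIndependent_prod_rowRealizations.inter
    (isOpen_genericSet finite_genericPolynomials genericPolynomials_subset)

lemma subset_closure_genericPairs :
    colRealizations 2 m ×ˢ rowRealizations 2 n ⊆ closure (genericPairs m n) :=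
  have hdense := dense_genericSet (finite_genericPolynomials (m := m) (n := n))
    genericPolynomials_subset
  (prod_mono_left fun _ hM => hM.1).trans
    (hdense.open_subset_closure_inter isOpen_convexIndependent_prod_rowRealizations)

lemma finite_vertices_homPolytope :
    (vertices (homPolytope (colPolytope z.1) (rowPolyhedron z.2))).Finite := by
  rw [homPolytope_colPolytope_rowPolyhedron]
  exact finite_vertices_polyhedron

lemma ncard_sdiff_simpleVertices_le (hm : 3 ≤ m) (hn : 2 ≤ n)
    (hz : z ∈ genericSet (genericPolynomials m n)) :
    (vertices (homPolytope (colPolytope z.1) (rowPolyhedron z.2)) \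
      simpleVertices (homPolytope (colPolytope z.1) (rowPolyhedron z.2))).ncard ≤ n * 3 ^ m := by
  have hl := inGeneralPosition_of_mem_genericSet hz hn
  have hp := secantsNotParallel_of_mem_genericSet hz
  have hdim : Module.finrank ℝ ((Fin 2 → ℝ) →ᵃ[ℝ] (Fin 2 → ℝ)) = 2 * 3 := by
    simp [AffineMap.finrank_eq]
  have hcount := hl.ncard_vertices_common_tight_le (p := z.1.col) (by simp)
  rw [Nat.card_fin, Fintype.card_fin] at hcount
  rw [homPolytope_colPolytope_rowPolyhedron]
  refine (ncard_le_ncard ?_ (finite_vertices_polyhedron.sep _)).trans hcount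
  rintro f ⟨hf, hns⟩
  have hcard := finrank_lt_ncard_tight_of_notMem_simpleVertices
    (homForm_const_lt (rowForm_zero_lt_one z.2)) hf hns
  exact ⟨hf, exists_common_tight_of_not_injective hl hp (by simp) (by simpa using hm) hf.1
    (by simpa [hdim] using hcard) (not_injective_linear_of_mem_genericSet hz hn hf hcard)⟩

lemma sq_le_eight_mul_ncard_simpleVertices (hm : 3 ≤ m) (hn : 16 ≤ n) (hz : z ∈ genericPairs m n) :
    n ^ 2 ≤ 8 * (simpleVertices (homPolytope (colPolytope z.1) (rowPolyhedron z.2))).ncard := by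
  obtain ⟨⟨-, hrow⟩, hgen⟩ := hz
  obtain ⟨hcomp, hirr⟩ := mem_rowRealizations_iff.1 hrow
  have hl := inGeneralPosition_of_mem_genericSet hgen (by lia)
  have hvertices := hl.card_le_finrank_mul_ncard_vertices hcomp hirr
  have hsq := hl.sq_ncard_vertices_le (by simp)
  have hpairs := ncard_disjointPairs_le_ncard_simpleVertices (rowForm_zero_lt_one z.2) hl
    (secantsNotParallel_of_mem_genericSet hgen) (by simp) (by simpa using hm)
  rw [homPolytope_colPolytope_rowPolyhedron]
  simp only [Nat.card_fin, Module.finrank_fin_fun] at hvertices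
  nlinarith

lemma abs_simpleRatio_sub_one_eq {E : Type*} [AddCommGroup E] [Module ℝ E] {X : Set E}
    (hfin : (vertices X).Finite) (hne : (vertices X).Nonempty) :
    |simpleRatio X - 1| = (vertices X \ simpleVertices X).ncard / (vertices X).ncard := by
  have hpos : (0 : ℝ) < (vertices X).ncard := by exact_mod_cast (ncard_pos hfin).2 hne
  have hadd : ((vertices X \ simpleVertices X).ncard : ℝ) + (simpleVertices X).ncard =
      (vertices X).ncard := by
    exact_mod_cast ncard_sdiff_add_ncard_of_subset (sep_subset _ _) hfin
  rw [simpleRatio, div_sub_one hpos.ne', ← hadd, sub_add_cancel_right, abs_div, abs_neg, hadd,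
    Nat.abs_cast, Nat.abs_cast]

lemma abs_simpleRatio_sub_one_le (hm : 3 ≤ m) (hn : 16 ≤ n) (hz : z ∈ genericPairs m n) :
    |simpleRatio (homPolytope (colPolytope z.1) (rowPolyhedron z.2)) - 1| ≤ 8 * 3 ^ m / n := by
  set X := homPolytope (colPolytope z.1) (rowPolyhedron z.2)
  have hfin : (vertices X).Finite := finite_vertices_homPolytope
  have hn₀ : (0 : ℝ) < n := by exact_mod_cast (by lia : 0 < n)
  have hsq : (n : ℝ) ^ 2 ≤ 8 * (vertices X).ncard := by
    exact_mod_cast (sq_le_eight_mul_ncard_simpleVertices hm hn hz).trans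
      (Nat.mul_le_mul_left 8 (ncard_le_ncard (sep_subset _ _) hfin))
  have hpos : (0 : ℝ) < (vertices X).ncard := by nlinarith
  have hns : ((vertices X \ simpleVertices X).ncard : ℝ) ≤ n * 3 ^ m := by
    exact_mod_cast ncard_sdiff_simpleVertices_le hm (by lia) hz.2
  rw [abs_simpleRatio_sub_one_eq hfin ((ncard_pos hfin).1 (by exact_mod_cast hpos)),
    div_le_div_iff₀ hpos hn₀]
  calc ((vertices X \ simpleVertices X).ncard : ℝ) * n ≤ n * 3 ^ m * n := by gcongr
    _ = 3 ^ m * n ^ 2 := by ring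
    _ ≤ 3 ^ m * (8 * (vertices X).ncard) := by gcongr
    _ = 8 * 3 ^ m * (vertices X).ncard := by ring

end SimpleRatio

end HomPolytope

theorem mainTheorem11 :
    ∃ V : (m n : ℕ) → Set (Matrix (Fin 2) (Fin m) ℝ × Matrix (Fin n) (Fin 2) ℝ),
      (∀ m n : ℕ, 3 ≤ m → 3 ≤ n →
        V m n ⊆ HomPolytope.colRealizations 2 m ×ˢ HomPolytope.rowRealizations 2 n ∧
        IsOpen (V m n) ∧
        HomPolytope.colRealizations 2 m ×ˢ HomPolytope.rowRealizations 2 n ⊆ closure (V m n)) ∧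
      ∀ m : ℕ, 3 ≤ m → ∀ ε : ℝ, 0 < ε → ∃ N : ℕ, ∀ n : ℕ, 3 ≤ n → N ≤ n →
        ∀ (M : Matrix (Fin 2) (Fin m) ℝ) (M' : Matrix (Fin n) (Fin 2) ℝ), (M, M') ∈ V m n →
          |HomPolytope.simpleRatio (HomPolytope.homPolytope (HomPolytope.colPolytope M)
            (HomPolytope.rowPolyhedron M')) - 1| < ε := by
  refine ⟨HomPolytope.genericPairs, fun m n hm _ => ⟨HomPolytope.genericPairs_subset hm,
    HomPolytope.isOpen_genericPairs, HomPolytope.subset_closure_genericPairs⟩, fun m hm ε hε => ?_⟩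
  obtain ⟨N, hN⟩ := exists_nat_gt (8 * 3 ^ m / ε)
  refine ⟨max N 16, fun n _ hn M M' hz => ?_⟩
  obtain ⟨hNn, hn16⟩ := max_le_iff.1 hn
  have hn₀ : (0 : ℝ) < n := by exact_mod_cast (by lia : 0 < n)
  calc _ ≤ 8 * 3 ^ m / (n : ℝ) := HomPolytope.abs_simpleRatio_sub_one_le hm hn16 hz
    _ < ε := (div_lt_comm₀ hn₀ hε).2 (hN.trans_le (by exact_mod_cast hNn))
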